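/- For a represented space $(X,\delta)$, with $\delta:\subseteq\mathbb{N}^{\mathbb{N}}\to X$ a surjective partial map, let $\mathcal{A}_-(X)$ be the set of closed subsets of $X$ (those $A\subseteq X$ for which the characteristic function of $X\setminus A$, as a map from $X$ to Sierpiński space, has a continuous realizer), where a name of $A$ is a name of the characteristic function of $X\setminus A$ in the canonical function space representation. Closed choice is the partial multi-valued map $\mathsf{C}_X:\subseteq\mathcal{A}_-(X)\rightrightarrows X$, $A\mapsto A$, defined for $A\neq\emptyset$. For partial multi-valued maps $f,g$ on represented spaces, $f\le_{\mathrm{W}} g$ means that there are computable partial functions $K,H:\subseteq\mathbb{N}^{\mathbb{N}}\to\mathbb{N}^{\mathbb{N}}$ such that $K\circ\langle\mathrm{id},G\circ H\rangle$ realizes $f$ for every realizer $G$ of $g$; $f\equiv_{\mathrm{W}}g$ means $f\le_{\mathrm{W}}g$ and $g\le_{\mathrm{W}}f$; and $(f\times g)(x,w)=f(x)\times g(w)$. A computable metric space $(X,d,\alpha)$ is a metric space with a sequence $\alpha:\mathbb{N}\to X$ of dense range such that $(i,j)\mapsto d(\alpha(i),\alpha(j))$ is computable; it is represented by its Cauchy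 representation. It is a computable $K_\sigma$-space if there is a computable sequence $(K_i)_{i\in\mathbb{N}}$ of non-empty computably compact sets with $X=\bigcup_{i}K_i$; here a name of a compact set $K$ is an enumeration of all finite covers of $K$ by rational open balls each of which meets $K$, and the sequence is computable as a map from $\mathbb{N}$ to the compact sets so represented. (1) Every computable $K_\sigma$-space $X$ satisfies $\mathsf{C}_X\le_{\mathrm{W}}\mathsf{C}_{\mathbb{N}}\times\mathsf{C}_{\{0,1\}^{\mathbb{N}}}$. (2) For every $k\ge 1$, $$\mathsf{C}_{\mathbb{R}^k}\equiv_{\mathrm{W}}\mathsf{C}_{\mathbb{R}}\equiv_{\mathrm{W}}\mathsf{C}_{\mathbb{N}\times\{0,1\}^{\mathbb{N}}}\equiv_{\mathrm{W}}\mathsf{C}_{\mathbb{N}}\times\mathsf{C}_{\{0,1\}^{\mathbb{N}}},$$ where $\mathbb{N}$, $\{0,1\}^{\mathbb{N}}$ and the product $\mathbb{N}\times\{0,1\}^{\mathbb{N}}$ carry their standard representations, and $\mathbb{R}$ and $\mathbb{R}^k$ (with the Euclidean metric) are represented by the Cauchy representations for standard numberings of the rational numbers and of the rational points. -/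

import Mathlib

open Set Filter Topology

namespace TTE

/-! ### Computability on Baire space -/

/-- Baire space, with the product topology of the discrete spaces `ℕ`. -/
abbrev Baire : Type := ℕ → ℕ

/-- The prefix of length `m` of `p`. -/
def word (p : Baire) (m : ℕ) : List ℕ := (List.range m).map p

/-- Type-2 computability of a partial function `F :⊆ ℕ^ℕ → ℕ^ℕ`: a computable function `φ` on finite
words, monotone for the prefix order, gives for each prefix of the input a prefix of the output;
`F p` is defined, with value `q`, exactly if the output words obtained are the prefixes of the
infinite sequence `q`. -/
def ComputableBaire (F : Baire →. Baire) : Prop :=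
  ∃ φ : List ℕ → List ℕ, Computable φ ∧ (∀ v w, v <+: w → φ v <+: φ w) ∧
    ∀ p q, q ∈ F p ↔ ∀ n, ∃ m, word q n <+: φ (word p m)

/-- An effective bijective pairing of Baire space with itself. -/
def pairB (p q : Baire) : Baire := fun n => Nat.pair (p n) (q n)

/-- First projection of the pairing. -/
def fstB (r : Baire) : Baire := fun n => (Nat.unpair (r n)).1

/-- Second projection of the pairing. -/
def sndB (r : Baire) : Baire := fun n => (Nat.unpair (r n)).2

theorem fstB_pairB (p q : Baire) : fstB (pairB p q) = p := by
  funext n; simp [fstB, pairB]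

theorem sndB_pairB (p q : Baire) : sndB (pairB p q) = q := by
  funext n; simp [sndB, pairB]

/-! ### Represented spaces, multi-valued functions, realizers, Weihrauch reducibility -/

/-- A representation of `X`: a surjective single-valued partial function `δ :⊆ ℕ^ℕ → X`, given by
its graph; `names p x` says that `δ p` is defined and equal to `x`. -/
structure BaireRep (X : Type*) where
  names : Baire → X → Prop
  unique : ∀ p x y, names p x → names p y → x = y
  surj : ∀ x, ∃ p, names p x

/-- A multi-valued partial function between represented spaces. Its domain is the set of all `x`
for which the set `val x` of possible values is non-empty. -/
structure MultiFun {X Y : Type*} (δX : BaireRep X) (δY : BaireRep Y) where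
  val : X → Set Y

/-- A single-valued total function, as a multi-valued one. -/
def MultiFun.ofFun {X Y : Type*} (δX : BaireRep X) (δY : BaireRep Y) (f : X → Y) :
    MultiFun δX δY := ⟨fun x => {f x}⟩

/-- `F` is a realizer of `f`. -/
def Realizes {X Y : Type*} {δX : BaireRep X} {δY : BaireRep Y}
    (F : Baire →. Baire) (f : MultiFun δX δY) : Prop :=
  ∀ p x, δX.names p x → (f.val x).Nonempty → ∃ q ∈ F p, ∃ y ∈ f.val x, δY.names q y

/-- `f ≤_W g`: there are computable `K`, `H` such that `K ∘ ⟨id, G ∘ H⟩` realizes `f` for every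
realizer `G` of `g`. -/
def WeihrauchLE {X Y U V : Type*} {δX : BaireRep X} {δY : BaireRep Y}
    {δU : BaireRep U} {δV : BaireRep V} (f : MultiFun δX δY) (g : MultiFun δU δV) : Prop :=
  ∃ K H : Baire →. Baire, ComputableBaire K ∧ ComputableBaire H ∧
    ∀ G : Baire →. Baire, Realizes G g →
      Realizes (fun p => (H p).bind fun h => (G h).bind fun r => K (pairB p r)) f

/-- Weihrauch equivalence. -/
def WeihrauchEquiv {X Y U V : Type*} {δX : BaireRep X} {δY : BaireRep Y}
    {δU : BaireRep U} {δV : BaireRep V} (f : MultiFun δX δY) (g : MultiFun δU δV) : Prop :=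
  WeihrauchLE f g ∧ WeihrauchLE g f

/-- A function between represented spaces is computable if it has a computable realizer. -/
def ComputableMap {X Y : Type*} (δX : BaireRep X) (δY : BaireRep Y) (f : X → Y) : Prop :=
  ∃ F : Baire →. Baire, ComputableBaire F ∧ Realizes F (MultiFun.ofFun δX δY f)

/-- A function between represented spaces is continuous if it has a realizer that is continuous on
its domain. -/
def ContinuousMapRep {X Y : Type*} (δX : BaireRep X) (δY : BaireRep Y) (f : X → Y) : Prop :=
  ∃ F : Baire →. Baire, Continuous F.asSubtype ∧ Realizes F (MultiFun.ofFun δX δY f)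

/-- The product representation `[δX, δY]`. -/
def prodRep {X Y : Type*} (δX : BaireRep X) (δY : BaireRep Y) : BaireRep (X × Y) where
  names r z := δX.names (fstB r) z.1 ∧ δY.names (sndB r) z.2
  unique _ _ _ h h' := Prod.ext (δX.unique _ _ _ h.1 h'.1) (δY.unique _ _ _ h.2 h'.2)
  surj z := by
    obtain ⟨p, hp⟩ := δX.surj z.1
    obtain ⟨q, hq⟩ := δY.surj z.2
    exact ⟨pairB p q, by rwa [fstB_pairB], by rwa [sndB_pairB]⟩

/-- The product of two multi-valued functions. -/
def MultiFun.prod {X Y W Z : Type*} {δX : BaireRep X} {δY : BaireRep Y}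
    {δW : BaireRep W} {δZ : BaireRep Z} (f : MultiFun δX δY) (g : MultiFun δW δZ) :
    MultiFun (prodRep δX δW) (prodRep δY δZ) :=
  ⟨fun z => f.val z.1 ×ˢ g.val z.2⟩

/-! ### Function spaces -/

/-- The partial continuous function `η_p` coded by `p`: to find the `n`-th value at `q`, query `p`
at `n` and longer and longer prefixes of `q` until a non-zero answer `k + 1` is given; then the
value is `k`. -/
def eta (p : Baire) : Baire →. Baire := fun q =>
  ⟨∀ n, ∃ m, p (Encodable.encode (n, word q m)) ≠ 0,
    fun h n => p (Encodable.encode (n, word q (Nat.find (h n)))) - 1⟩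

theorem word_eq_iff (p q : Baire) (m : ℕ) : word p m = word q m ↔ ∀ i < m, p i = q i := by
  simp [word, List.map_inj_left]

/-- Every partial continuous function on Baire space is extended by some `η_p`. -/
theorem exists_eta (F : Baire →. Baire) (hF : Continuous F.asSubtype) :
    ∃ p, ∀ q y, y ∈ F q → y ∈ eta p q := by
  classical
  -- `D n w k`: all values of `F` at arguments with prefix `w` have `n`-th entry `k`, and there is one
  let D : ℕ → List ℕ → ℕ → Prop := fun n w k =>
    (∃ q y, y ∈ F q ∧ word q w.length = w) ∧
      ∀ q y, y ∈ F q → word q w.length = w → y n = k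
  let p : Baire := fun c =>
    let d := Denumerable.ofNat (ℕ × List ℕ) c
    if h : ∃ k, D d.1 d.2 k then h.choose + 1 else 0
  have hlen : ∀ (q : Baire) m, (word q m).length = m := fun q m => by simp [word]
  have hval : ∀ q y, y ∈ F q → ∀ n m : ℕ, p (Encodable.encode (n, word q m)) ≠ 0 →
      p (Encodable.encode (n, word q m)) - 1 = y n := by
    intro q y hy n m hne
    simp only [p, Denumerable.ofNat_encode] at hne ⊢
    by_cases h : ∃ k, D n (word q m) k
    · rw [dif_pos h]
      have := h.choose_spec.2 q y hy (by rw [hlen])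
      simp [this]
    · simp [h] at hne
  refine ⟨p, fun q y hy => ?_⟩
  have hdom : ∀ n : ℕ, ∃ m, p (Encodable.encode (n, word q m)) ≠ 0 := by
    intro n
    have hq : q ∈ F.Dom := Part.dom_iff_mem.2 ⟨y, hy⟩
    have hc : Continuous fun x : F.Dom => F.asSubtype x n := (continuous_apply n).comp hF
    have hopen : IsOpen ((fun x : F.Dom => F.asSubtype x n) ⁻¹' {y n}) :=
      (isOpen_discrete _).preimage hc
    obtain ⟨U, hU, hUeq⟩ := isOpen_induced_iff.1 hopen
    have hgen : ∀ z : Baire, ∀ x (hx : x ∈ F.Dom), z ∈ F x → F.asSubtype ⟨x, hx⟩ = z :=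
      fun z x hx hz => Part.get_eq_of_mem hz hx
    have hqU : q ∈ U := by
      have : (⟨q, hq⟩ : F.Dom) ∈ Subtype.val ⁻¹' U := by
        rw [hUeq]
        simp [hgen y q hq hy]
      exact this
    obtain ⟨I, u, hu, hIU⟩ := isOpen_pi_iff.1 hU q hqU
    refine ⟨I.sup id + 1, ?_⟩
    have h : ∃ k, D n (word q (I.sup id + 1)) k := by
      refine ⟨y n, ⟨q, y, hy, by rw [hlen]⟩, fun q' y' hy' hw => ?_⟩
      rw [hlen, word_eq_iff] at hw
      have hq' : q' ∈ F.Dom := Part.dom_iff_mem.2 ⟨y', hy'⟩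
      have hq'U : q' ∈ U := by
        apply hIU
        intro i hi
        rw [hw i (Nat.lt_succ_of_le (Finset.le_sup (f := id) hi))]
        exact (hu i hi).2
      have : (⟨q', hq'⟩ : F.Dom) ∈ (fun x : F.Dom => F.asSubtype x n) ⁻¹' {y n} := by
        rw [← hUeq]; exact hq'U
      simpa [hgen y' q' hq' hy'] using this
    simp only [p, Denumerable.ofNat_encode]
    rw [dif_pos h]
    simp
  exact ⟨hdom, funext fun n => hval q y hy n _ (Nat.find_spec (hdom n))⟩

/-- The canonical function space representation `[δX → δY]` of the continuous functions:
`p` is a name of `f` if `η_p` realizes `f`. -/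
def funRep {X Y : Type*} (δX : BaireRep X) (δY : BaireRep Y) :
    BaireRep {f : X → Y // ContinuousMapRep δX δY f} where
  names p f := Realizes (eta p) (MultiFun.ofFun δX δY f.1)
  unique p f g hf hg := by
    refine Subtype.ext (funext fun x => ?_)
    obtain ⟨q, hq⟩ := δX.surj x
    obtain ⟨r, hr, y, hy, hry⟩ := hf q x hq ⟨_, rfl⟩
    obtain ⟨r', hr', y', hy', hry'⟩ := hg q x hq ⟨_, rfl⟩
    obtain rfl := Part.mem_unique hr hr'
    obtain rfl : y = f.1 x := hy
    obtain rfl : y' = g.1 x := hy'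
    exact δY.unique _ _ _ hry hry'
  surj f := by
    obtain ⟨F, hF, hr⟩ := f.2
    obtain ⟨p, hp⟩ := exists_eta F hF
    refine ⟨p, fun q x hq hne => ?_⟩
    obtain ⟨r, hr, h⟩ := hr q x hq hne
    exact ⟨r, hp q r hr, h⟩

/-! ### Closed sets with negative information and closed choice -/

/-- Sierpiński space, with the truth values `True` and `False` as its points `1` and `0`:
`p` is a name of `1` if and only if some `p n` is `0`. -/
def sierpinskiRep : BaireRep Prop where
  names p s := s ↔ ∃ n, p n = 0
  unique _ _ _ h h' := propext (h.trans h'.symm)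
  surj s := by
    by_cases h : s
    · exact ⟨fun _ => 0, by simp [h]⟩
    · exact ⟨fun _ => 1, by simp [h]⟩

/-- The closed subsets of a represented space: those for which the characteristic function of the
complement, as a map to Sierpiński space, is continuous. -/
def ClosedSets {X : Type*} (δ : BaireRep X) : Type _ :=
  {A : Set X // ContinuousMapRep δ sierpinskiRep (fun x => x ∈ Aᶜ)}

/-- The negative information representation `ψ_-` of the closed sets: a name of `A` is a
`[δ → δ_𝕊]`-name of the characteristic function of the complement of `A`. -/
def closedRep {X : Type*} (δ : BaireRep X) : BaireRep (ClosedSets δ) where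
  names p A := (funRep δ sierpinskiRep).names p ⟨fun x => x ∈ A.1ᶜ, A.2⟩
  unique p A B hA hB := by
    have h := congrArg Subtype.val ((funRep δ sierpinskiRep).unique p _ _ hA hB)
    refine Subtype.ext (compl_injective ?_)
    exact Set.ext fun x => iff_of_eq (congrFun h x)
  surj A := (funRep δ sierpinskiRep).surj _

/-- Closed choice `C_X :⊆ A_-(X) ⇉ X`, `A ↦ A`, defined on the non-empty closed sets. -/
def closedChoice {X : Type*} (δ : BaireRep X) : MultiFun (closedRep δ) δ :=
  ⟨fun A => A.1⟩

/-! ### The natural numbers and Cantor space -/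

/-- The representation `p ↦ p 0` of `ℕ`. -/
def natRep : BaireRep ℕ where
  names p n := p 0 = n
  unique _ _ _ h h' := h.symm.trans h'
  surj n := ⟨fun _ => n, rfl⟩

/-- The representation of Cantor space `{0,1}^ℕ` by its points, as elements of Baire space. -/
def cantorRep : BaireRep (ℕ → Bool) where
  names p x := ∀ n, p n = (x n).toNat
  unique _ x y h h' := funext fun n => by
    have e : (x n).toNat = (y n).toNat := (h n).symm.trans (h' n)
    revert e; cases x n <;> cases y n <;> simp
  surj x := ⟨fun n => (x n).toNat, fun _ => rfl⟩

/-! ### Metric spaces -/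

/-- The Cauchy representation of a metric space with dense sequence `α`: a name of `x` is a
sequence of indices of a rapidly converging sequence with limit `x`. -/
def cauchyRep {X : Type*} [MetricSpace X] (α : ℕ → X) (hα : DenseRange α) : BaireRep X where
  names p x := (∀ i j, j < i → dist (α (p i)) (α (p j)) < (1 / 2 : ℝ) ^ j) ∧
    Tendsto (fun n => α (p n)) atTop (𝓝 x)
  unique _ _ _ h h' := tendsto_nhds_unique h.2 h'.2
  surj x := by
    have h : ∀ n : ℕ, ∃ k, dist x (α k) < (1 / 2 : ℝ) ^ (n + 1) := fun n =>
      hα.exists_dist_lt x (by positivity)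
    choose p hp using h
    refine ⟨p, fun i j hij => ?_, ?_⟩
    · have h1 := dist_triangle_left (α (p i)) (α (p j)) x
      have h2 : (1 / 2 : ℝ) ^ (i + 1) ≤ (1 / 2 : ℝ) ^ (j + 1) :=
        pow_le_pow_of_le_one (by norm_num) (by norm_num) (by omega)
      have h3 : (1 / 2 : ℝ) ^ (j + 1) = (1 / 2 : ℝ) ^ j / 2 := by rw [pow_succ]; ring
      have h4 := hp i
      have h5 := hp j
      linarith
    · rw [tendsto_iff_dist_tendsto_zero]
      have h0 : Tendsto (fun n : ℕ => (1 / 2 : ℝ) ^ (n + 1)) atTop (𝓝 0) :=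
        (tendsto_pow_atTop_nhds_zero_of_lt_one (by norm_num) (by norm_num)).comp
          (tendsto_add_atTop_nat 1)
      refine squeeze_zero (fun _ => dist_nonneg) (fun n => ?_) h0
      rw [dist_comm]; exact (hp n).le

/-- A standard numbering of the rational numbers. -/
def ratNum (n : ℕ) : ℚ :=
  ((n.unpair.1 : ℚ) - (n.unpair.2.unpair.1 : ℚ)) / ((n.unpair.2.unpair.2 : ℚ) + 1)

theorem ratNum_surjective : Function.Surjective ratNum := by
  intro q
  refine ⟨Nat.pair q.num.toNat (Nat.pair (-q.num).toNat (q.den - 1)), ?_⟩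
  have h1 : ((q.num.toNat : ℚ) - ((-q.num).toNat : ℚ)) = (q.num : ℚ) := by
    have : ((q.num.toNat : ℤ) - ((-q.num).toNat : ℤ)) = q.num := by omega
    exact_mod_cast this
  have h2 : (((q.den - 1 : ℕ) : ℚ) + 1) = (q.den : ℚ) := by
    have := q.den_pos
    have h : q.den - 1 + 1 = q.den := by omega
    exact_mod_cast h
  simp only [ratNum, Nat.unpair_pair]
  rw [h1, h2, Rat.num_div_den]

/-- A computable metric space `(X, d, α)`: `α` numbers a dense subset, and the distances of its
members are computable real numbers, uniformly in the indices. -/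
structure ComputableMetricSpace (X : Type*) [MetricSpace X] where
  α : ℕ → X
  dense : DenseRange α
  dist_computable : ∃ a : ℕ × ℕ × ℕ → ℕ, Computable a ∧
    ∀ i j m, |(ratNum (a (i, j, m)) : ℝ) - dist (α i) (α j)| ≤ (1 / 2 : ℝ) ^ m

/-- The Cauchy representation of a computable metric space. -/
def ComputableMetricSpace.rep {X : Type*} [MetricSpace X] (M : ComputableMetricSpace X) :
    BaireRep X := cauchyRep M.α M.dense

/-- The rational open ball with centre `α b.1` whose radius is the rational number with index
`b.2`. -/
def ratBall {X : Type*} [MetricSpace X] (α : ℕ → X) (b : ℕ × ℕ) : Set X :=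
  Metric.ball (α b.1) (ratNum b.2 : ℝ)

/-- `n` codes a finite list of rational open balls that covers `K`, each of which meets `K`. -/
def IsCoverCode {X : Type*} [MetricSpace X] (α : ℕ → X) (K : Set X) (n : ℕ) : Prop :=
  (K ⊆ ⋃ b ∈ Denumerable.ofNat (List (ℕ × ℕ)) n, ratBall α b) ∧
    ∀ b ∈ Denumerable.ofNat (List (ℕ × ℕ)) n, (ratBall α b ∩ K).Nonempty

theorem exists_coverCode {X : Type*} [MetricSpace X] {α : ℕ → X} (hα : DenseRange α)
    {K U : Set X} (hK : IsCompact K) (hU : IsOpen U) (hKU : K ⊆ U) :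
    ∃ n, IsCoverCode α K n ∧
      ∀ b ∈ Denumerable.ofNat (List (ℕ × ℕ)) n, ratBall α b ⊆ U := by
  have h : ∀ y ∈ K, ∃ b : ℕ × ℕ, y ∈ ratBall α b ∧ ratBall α b ⊆ U := by
    intro y hy
    obtain ⟨ε, hε, hball⟩ := Metric.isOpen_iff.1 hU y (hKU hy)
    obtain ⟨i, hi⟩ := hα.exists_dist_lt y (show 0 < ε / 2 by positivity)
    obtain ⟨q, hq1, hq2⟩ := exists_rat_btwn hi
    obtain ⟨j, rfl⟩ := ratNum_surjective q
    refine ⟨(i, j), hq1, fun z hz => hball ?_⟩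
    have hz' : dist z (α i) < (ratNum j : ℝ) := hz
    have := dist_triangle_right z y (α i)
    rw [Metric.mem_ball]
    linarith
  choose! b hb using h
  obtain ⟨t, htK, ht⟩ := hK.elim_nhds_subcover (fun y => ratBall α (b y))
    (fun y hy => Metric.isOpen_ball.mem_nhds (hb y hy).1)
  refine ⟨Encodable.encode (t.toList.map b), ⟨?_, ?_⟩, ?_⟩
  · rw [Denumerable.ofNat_encode]
    intro z hz
    obtain ⟨y, hy, hzy⟩ := mem_iUnion₂.1 (ht hz)
    exact mem_iUnion₂.2 ⟨b y, List.mem_map.2 ⟨y, by simpa using hy, rfl⟩, hzy⟩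
  · rw [Denumerable.ofNat_encode]
    intro c hc
    obtain ⟨y, hy, rfl⟩ := List.mem_map.1 hc
    have hyK := htK y (by simpa using hy)
    exact ⟨y, (hb y hyK).1, hyK⟩
  · rw [Denumerable.ofNat_encode]
    intro c hc
    obtain ⟨y, hy, rfl⟩ := List.mem_map.1 hc
    exact (hb y (htK y (by simpa using hy))).2

/-- The representation `κ` of the compact subsets: a name of `K` is a list of all finite covers of
`K` by rational open balls that all meet `K`. -/
def compactRep {X : Type*} [MetricSpace X] (α : ℕ → X) (hα : DenseRange α) :
    BaireRep (TopologicalSpace.Compacts X) where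
  names p K := Set.range p = {n | IsCoverCode α (K : Set X) n}
  unique p K L hK hL := by
    have key : ∀ K L : TopologicalSpace.Compacts X,
        {n | IsCoverCode α (K : Set X) n} = {n | IsCoverCode α (L : Set X) n} →
        (L : Set X) ⊆ K := by
      intro K L h x hx
      by_contra hxK
      obtain ⟨n, hn, hnU⟩ := exists_coverCode hα K.isCompact
        (isOpen_compl_singleton (x := x)) (fun y hy => by rintro rfl; exact hxK hy)
      have hn' : IsCoverCode α (L : Set X) n := by
        have : n ∈ {n | IsCoverCode α (L : Set X) n} := h ▸ hn
        exact this
      obtain ⟨b, hb, hxb⟩ := mem_iUnion₂.1 (hn'.1 hx)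
      exact hnU b hb hxb rfl
    have e := hK.symm.trans hL
    exact SetLike.coe_injective (Subset.antisymm (key L K e.symm) (key K L e))
  surj K := by
    obtain ⟨n, hn, _⟩ := exists_coverCode hα K.isCompact isOpen_univ (subset_univ _)
    obtain ⟨p, hp⟩ := (Set.to_countable {n | IsCoverCode α (K : Set X) n}).exists_eq_range ⟨n, hn⟩
    exact ⟨p, hp.symm⟩

/-- A computable `K_σ`-space: it is the union of a computable sequence of non-empty computably
compact sets. -/
def ComputableMetricSpace.IsKSigma {X : Type*} [MetricSpace X]
    (M : ComputableMetricSpace X) : Prop :=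
  ∃ K : ℕ → TopologicalSpace.Compacts X,
    ComputableMap natRep (compactRep M.α M.dense) K ∧
    (∀ i, (K i : Set X).Nonempty) ∧ ⋃ i, (K i : Set X) = univ

/-! ### Euclidean spaces -/

theorem denseRange_ratNum : DenseRange (fun n => (ratNum n : ℝ)) :=
  Rat.denseRange_cast.comp ratNum_surjective.denseRange Rat.continuous_coe_real

/-- The Cauchy representation `ρ` of `ℝ`. -/
noncomputable def realRep : BaireRep ℝ := cauchyRep (fun n => (ratNum n : ℝ)) denseRange_ratNum

/-- Entry `i` of the sequence of natural numbers coded by `n`. -/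
def entry (n i : ℕ) : ℕ := (Nat.unpair ((fun m => (Nat.unpair m).2)^[i] n)).1

theorem exists_entry (k : ℕ) : ∀ a : ℕ → ℕ, ∃ n, ∀ i < k, entry n i = a i := by
  induction k with
  | zero => exact fun _ => ⟨0, by simp⟩
  | succ k ih =>
    intro a
    obtain ⟨n, hn⟩ := ih fun i => a (i + 1)
    refine ⟨Nat.pair (a 0) n, fun i hi => ?_⟩
    cases i with
    | zero => simp [entry]
    | succ i =>
      have := hn i (by omega)
      simpa [entry, Function.iterate_succ_apply] using this

/-- A standard numbering of the points of `ℝ^k` with rational coordinates. -/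
noncomputable def ratVec (k : ℕ) (n : ℕ) : EuclideanSpace ℝ (Fin k) :=
  WithLp.toLp 2 fun i => (ratNum (entry n i) : ℝ)

theorem denseRange_ratVec (k : ℕ) : DenseRange (ratVec k) := by
  have h1 : DenseRange (Pi.map fun (_ : Fin k) (n : ℕ) => (ratNum n : ℝ)) :=
    DenseRange.piMap fun _ => denseRange_ratNum
  have h2 : DenseRange (WithLp.toLp 2 ∘ (Pi.map fun (_ : Fin k) (n : ℕ) => (ratNum n : ℝ))) :=
    (WithLp.toLp_surjective 2).denseRange.comp h1 (PiLp.continuous_toLp 2 _)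
  refine h2.mono ?_
  rintro _ ⟨a, rfl⟩
  obtain ⟨n, hn⟩ := exists_entry k fun i => if h : i < k then a ⟨i, h⟩ else 0
  refine ⟨n, ?_⟩
  simp only [ratVec, Function.comp]
  congr 1
  funext i
  simp [hn i i.2]

/-- The Cauchy representation of `ℝ^k`. -/
noncomputable def euclideanRep (k : ℕ) : BaireRep (EuclideanSpace ℝ (Fin k)) :=
  cauchyRep (ratVec k) (denseRange_ratVec k)

end TTE

/-! All reductions but two come from one principle, `closedChoice_reduction`. Let `e` map a subset
`D` of `X` onto `Y`, let `e` be computable on names, and let the complement of `D` be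
semi-decidable. Then `C_Y` reduces to `C_X`: from a name of `A ⊆ Y` one computes a name of `D ∩
e⁻¹(A)`, and `e` sends each of its points into `A`.

Three total surjections and one partial one are used. Integer parts and binary expansions map `ℕ ×
{0,1}^ℕ` onto `ℝ^k`; a coordinate projection maps `ℝ^k` onto `ℝ`; the reals `m + ∑ 2 yᵢ 4^{-i-1}`
form a closed set that decodes onto `ℕ × {0,1}^ℕ`. For a `K_σ`-space, `(i, y)` selects at each
precision a ball from a finite cover of `K i`. Selected centres need not converge, so `walk` skips
the jumps; compactness of `K i` then gives a limit even when `X` is incomplete, and coherent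
selections are left unchanged.

The other two reductions concern products. `C_ℕ × C_{{0,1}^ℕ}` reduces to choice on the product
space because a product of closed sets is closed. The converse, `closedChoice_natCantor_reduction`,
is the delicate one: the two choices are made in parallel, so the Cantor point cannot depend on the
chosen integer. It therefore encodes one sequence for every section of `A` at once. A section is a
binary tree, and its sequence must stay in the tree only on those levels that are non-empty. This
closed condition is satisfiable even when some trees are finite (`exists_branch`). The integer is
chosen among those whose tree has no empty level, and for it the decoded sequence is an infinite
branch.

Computability is handled by `CRel`, a calculus of functions computed from finite oracle prefixes.
All functionals involved are total, so reductions compose pointwise (`TotalReduction`). -/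

namespace TTE

/-! ### Uniform computability relative to an oracle -/

section Relative

variable {α β σ τ : Type*} [Primcodable α] [Primcodable β] [Primcodable σ] [Primcodable τ]

/-- `φ` computes `f p a` from finite prefixes of the oracle `p`. -/
structure Approximates (φ : List ℕ × α → Option σ) (f : Baire → α → σ) : Prop where
  computable : Computable φ
  mono : ∀ v w a b, v <+: w → φ (v, a) = some b → φ (w, a) = some b
  total : ∀ p a, ∃ m, φ (word p m, a) = some (f p a)

/-- `f p a` is computable from `a` and the oracle `p`, uniformly in `p`. -/
def CRel (f : Baire → α → σ) : Prop := ∃ φ, Approximates φ f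

theorem length_word (p : Baire) (m : ℕ) : (word p m).length = m := by simp [word]

theorem word_prefix (p : Baire) {m n : ℕ} (h : m ≤ n) : word p m <+: word p n := by
  obtain ⟨k, rfl⟩ := Nat.exists_eq_add_of_le h
  simp [word, List.range_add]

namespace Approximates

variable {φ : List ℕ × α → Option σ} {f : Baire → α → σ}

theorem eventually (h : Approximates φ f) (p : Baire) (a : α) :
    ∀ᶠ m in atTop, φ (word p m, a) = some (f p a) := by
  obtain ⟨m, hm⟩ := h.total p a
  filter_upwards [eventually_ge_atTop m] with n hn
  exact h.mono _ _ _ _ (word_prefix p hn) hm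

theorem sound (h : Approximates φ f) {p : Baire} {a : α} {m : ℕ} {b : σ}
    (hb : φ (word p m, a) = some b) : b = f p a := by
  obtain ⟨n, hn, hmn⟩ := ((h.eventually p a).and (eventually_ge_atTop m)).exists
  have := h.mono _ _ _ _ (word_prefix p hmn) hb
  rw [hn] at this
  exact (Option.some.inj this).symm

end Approximates

namespace CRel

theorem of_computable {g : α → σ} (hg : Computable g) : CRel fun _ a => g a :=
  ⟨fun x => some (g x.2), Computable.option_some.comp (hg.comp Computable.snd),
    fun _ _ _ _ _ h => h, fun _ _ => ⟨0, rfl⟩⟩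

theorem const (c : σ) : CRel fun (_ : Baire) (_ : α) => c := of_computable (Computable.const c)

theorem id : CRel fun _ (a : α) => a := of_computable Computable.id

theorem fst : CRel fun _ (a : α × β) => a.1 := of_computable Computable.fst

theorem snd : CRel fun _ (a : α × β) => a.2 := of_computable Computable.snd

theorem oracle : CRel fun p (n : ℕ) => p n := by
  refine ⟨fun x => x.1[x.2]?, Computable.list_getElem?.comp Computable.fst Computable.snd,
    ?_, fun p a => ⟨a + 1, by simp [word]⟩⟩
  rintro v _ a b ⟨t, rfl⟩ h
  exact List.getElem?_append_left (List.getElem?_eq_some_iff.1 h).1 |>.trans h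

theorem comp {f : Baire → β → σ} {g : Baire → α → β} (hf : CRel f) (hg : CRel g) :
    CRel fun p a => f p (g p a) := by
  obtain ⟨φ, hφ⟩ := hf
  obtain ⟨ψ, hψ⟩ := hg
  refine ⟨fun x => (ψ x).bind fun b => φ (x.1, b), ?_, ?_, ?_⟩
  · exact Computable.option_bind hψ.computable
      (hφ.computable.comp ((Computable.fst.comp Computable.fst).pair Computable.snd)).to₂
  · intro v w a c hvw h
    obtain ⟨b, hb, hc⟩ := Option.bind_eq_some_iff.1 h
    exact Option.bind_eq_some_iff.2 ⟨b, hψ.mono _ _ _ _ hvw hb, hφ.mono _ _ _ _ hvw hc⟩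
  · intro p a
    obtain ⟨m, h1, h2⟩ := ((hψ.eventually p a).and (hφ.eventually p (g p a))).exists
    exact ⟨m, Option.bind_eq_some_iff.2 ⟨_, h1, h2⟩⟩

theorem pair {f : Baire → α → β} {g : Baire → α → σ} (hf : CRel f) (hg : CRel g) :
    CRel fun p a => (f p a, g p a) := by
  obtain ⟨φ, hφ⟩ := hf
  obtain ⟨ψ, hψ⟩ := hg
  refine ⟨fun x => (φ x).bind fun b => (ψ x).map fun c => (b, c), ?_, ?_, ?_⟩
  · exact Computable.option_bind hφ.computable
      (Computable.option_map (hψ.computable.comp Computable.fst)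
        ((Computable.snd.comp Computable.fst).pair Computable.snd).to₂).to₂
  · intro v w a c hvw h
    simp only [Option.bind_eq_some_iff, Option.map_eq_some_iff] at h ⊢
    obtain ⟨b, hb, d, hd, rfl⟩ := h
    exact ⟨b, hφ.mono _ _ _ _ hvw hb, d, hψ.mono _ _ _ _ hvw hd, rfl⟩
  · intro p a
    obtain ⟨m, h1, h2⟩ := ((hφ.eventually p a).and (hψ.eventually p a)).exists
    exact ⟨m, by simp [h1, h2]⟩

theorem of_eq {f g : Baire → α → σ} (hf : CRel f) (h : ∀ p a, f p a = g p a) : CRel g := by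
  obtain rfl : f = g := funext fun p => funext fun a => h p a
  exact hf

theorem map {f : Baire → α → β} {g : β → σ} (hg : Computable g) (hf : CRel f) :
    CRel fun p a => g (f p a) :=
  (of_computable hg).comp hf

theorem map₂ {f : Baire → α → β} {f' : Baire → α → τ} {g : β → τ → σ} (hg : Computable₂ g)
    (hf : CRel f) (hf' : CRel f') : CRel fun p a => g (f p a) (f' p a) :=
  (of_computable (g := fun x : β × τ => g x.1 x.2) hg).comp (hf.pair hf')

theorem nat_rec {n : Baire → α → ℕ} {f : Baire → α → σ} {g : Baire → α × ℕ × σ → σ}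
    (hn : CRel n) (hf : CRel f) (hg : CRel g) :
    CRel fun p a => (Nat.rec (f p a) (fun y ih => g p (a, y, ih)) (n p a) : σ) := by
  obtain ⟨ν, hν⟩ := hn
  obtain ⟨φ, hφ⟩ := hf
  obtain ⟨ψ, hψ⟩ := hg
  let R : List ℕ × α → ℕ → Option σ := fun x n =>
    Nat.rec (φ x) (fun y ih => ih.bind fun s => ψ (x.1, x.2, y, s)) n
  refine ⟨fun x => (ν x).bind (R x), ?_, ?_, ?_⟩
  · refine Computable.option_bind hν.computable (Computable₂.mk ?_)
    refine Computable.nat_rec (h := fun (z : (List ℕ × α) × ℕ) (u : ℕ × Option σ) =>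
        u.2.bind fun s => ψ (z.1.1, z.1.2, u.1, s))
      Computable.snd (hφ.computable.comp Computable.fst) (Computable₂.mk ?_)
    refine Computable.option_bind (Computable.snd.comp Computable.snd) (Computable₂.mk ?_)
    refine hψ.computable.comp ?_
    have h1 : Computable fun t : (((List ℕ × α) × ℕ) × ℕ × Option σ) × σ => t.1.1.1 :=
      Computable.fst.comp (Computable.fst.comp Computable.fst)
    have h2 : Computable fun t : (((List ℕ × α) × ℕ) × ℕ × Option σ) × σ => t.1.2.1 :=
      Computable.fst.comp (Computable.snd.comp Computable.fst)
    exact (Computable.fst.comp h1).pair ((Computable.snd.comp h1).pair (h2.pair Computable.snd))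
  · intro v w a c hvw h
    obtain ⟨n, hn, hc⟩ := Option.bind_eq_some_iff.1 h
    refine Option.bind_eq_some_iff.2 ⟨n, hν.mono _ _ _ _ hvw hn, ?_⟩
    clear h hn
    induction n generalizing c with
    | zero => exact hφ.mono _ _ _ _ hvw hc
    | succ n ih =>
      obtain ⟨s, hs, hc⟩ := Option.bind_eq_some_iff.1 hc
      exact Option.bind_eq_some_iff.2 ⟨s, ih _ hs, hψ.mono _ _ _ _ hvw hc⟩
  · intro p a
    -- Up to stage `k` only finitely many values of `φ` and `ψ` are needed, so all long enough
    -- prefixes supply them.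
    have key : ∀ k : ℕ, ∀ᶠ m in atTop, R (word p m, a) k =
        some (Nat.rec (f p a) (fun y ih => g p (a, y, ih)) k : σ) := by
      intro k
      induction k with
      | zero => exact hφ.eventually p a
      | succ k ih =>
        filter_upwards [ih, hψ.eventually p
          (a, k, (Nat.rec (f p a) (fun y ih => g p (a, y, ih)) k : σ))] with m h1 h2
        exact Option.bind_eq_some_iff.2 ⟨_, h1, h2⟩
    obtain ⟨m, h1, h2⟩ := ((hν.eventually p a).and (key (n p a))).exists
    exact ⟨m, Option.bind_eq_some_iff.2 ⟨_, h1, h2⟩⟩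

theorem tabulate {n : Baire → α → ℕ} {f : Baire → α × ℕ → σ} (hn : CRel n) (hf : CRel f) :
    CRel fun p a => (List.range (n p a)).map fun k => f p (a, k) := by
  have hg : CRel fun p (x : α × ℕ × List σ) => x.2.2 ++ [f p (x.1, x.2.1)] :=
    map₂ (g := fun (l : List σ) (b : σ) => l ++ [b]) Computable.list_concat (snd.comp snd)
      (hf.comp (fst.pair (fst.comp snd)))
  refine (nat_rec hn (const []) hg).of_eq fun p a => ?_
  induction n p a with
  | zero => rfl
  | succ k ih => rw [List.range_succ, List.map_append, ← ih]; rfl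

theorem sum {n : Baire → α → ℕ} {f : Baire → α × ℕ → ℕ} (hn : CRel n) (hf : CRel f) :
    CRel fun p a => ∑ k ∈ Finset.range (n p a), f p (a, k) := by
  have hg : CRel fun p (x : α × ℕ × ℕ) => x.2.2 + f p (x.1, x.2.1) :=
    map₂ Primrec.nat_add.to_comp (snd.comp snd) (hf.comp (fst.pair (fst.comp snd)))
  refine (nat_rec hn (const 0) hg).of_eq fun p a => ?_
  induction n p a with
  | zero => rfl
  | succ k ih => rw [Finset.sum_range_succ, ← ih]

theorem prod {n : Baire → α → ℕ} {f : Baire → α × ℕ → ℕ} (hn : CRel n) (hf : CRel f) :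
    CRel fun p a => ∏ k ∈ Finset.range (n p a), f p (a, k) := by
  have hg : CRel fun p (x : α × ℕ × ℕ) => x.2.2 * f p (x.1, x.2.1) :=
    map₂ Primrec.nat_mul.to_comp (snd.comp snd) (hf.comp (fst.pair (fst.comp snd)))
  refine (nat_rec hn (const 1) hg).of_eq fun p a => ?_
  induction n p a with
  | zero => rfl
  | succ k ih => rw [Finset.prod_range_succ, ← ih]

theorem cond {c : Baire → α → Bool} {f g : Baire → α → σ} (hc : CRel c) (hf : CRel f)
    (hg : CRel g) : CRel fun p a => bif c p a then f p a else g p a :=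
  (of_computable (g := fun x : Bool × σ × σ => bif x.1 then x.2.1 else x.2.2)
    (Computable.cond Computable.fst (Computable.fst.comp Computable.snd)
      (Computable.snd.comp Computable.snd))).comp (hc.pair (hf.pair hg))

theorem ite {c : Baire → α → Prop} [∀ p a, Decidable (c p a)] {f g : Baire → α → σ}
    (hc : CRel fun p a => decide (c p a)) (hf : CRel f) (hg : CRel g) :
    CRel fun p a => if c p a then f p a else g p a :=
  (cond hc hf hg).of_eq fun p a => by by_cases h : c p a <;> simp [h]

theorem decide_le {f g : Baire → α → ℕ} (hf : CRel f) (hg : CRel g) :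
    CRel fun p a => decide (f p a ≤ g p a) :=
  map₂ (Primrec₂.to_comp (f := fun a b : ℕ => decide (a ≤ b)) Primrec.nat_le.decide) hf hg

theorem decide_eq {f g : Baire → α → ℕ} (hf : CRel f) (hg : CRel g) :
    CRel fun p a => decide (f p a = g p a) :=
  map₂ (Primrec₂.to_comp (f := fun a b : ℕ => decide (a = b)) Primrec.eq.decide) hf hg

theorem decide_and {c d : Baire → α → Prop} [∀ p a, Decidable (c p a)]
    [∀ p a, Decidable (d p a)] (hc : CRel fun p a => decide (c p a))
    (hd : CRel fun p a => decide (d p a)) : CRel fun p a => decide (c p a ∧ d p a) :=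
  (map₂ Primrec.and.to_comp hc hd).of_eq fun p a => by simp

theorem add {f g : Baire → α → ℕ} (hf : CRel f) (hg : CRel g) : CRel fun p a => f p a + g p a :=
  map₂ Primrec.nat_add.to_comp hf hg

theorem mul {f g : Baire → α → ℕ} (hf : CRel f) (hg : CRel g) : CRel fun p a => f p a * g p a :=
  map₂ Primrec.nat_mul.to_comp hf hg

theorem sub {f g : Baire → α → ℕ} (hf : CRel f) (hg : CRel g) : CRel fun p a => f p a - g p a :=
  map₂ Primrec.nat_sub.to_comp hf hg

theorem div {f g : Baire → α → ℕ} (hf : CRel f) (hg : CRel g) : CRel fun p a => f p a / g p a :=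
  map₂ Primrec.nat_div.to_comp hf hg

theorem mod {f g : Baire → α → ℕ} (hf : CRel f) (hg : CRel g) : CRel fun p a => f p a % g p a :=
  map₂ Primrec.nat_mod.to_comp hf hg

theorem pow {f g : Baire → α → ℕ} (hf : CRel f) (hg : CRel g) : CRel fun p a => f p a ^ g p a :=
  map₂ (Primrec₂.to_comp (f := fun a b : ℕ => a ^ b) (Primrec₂.unpaired'.1 Nat.Primrec.pow)) hf hg

theorem natPair {f g : Baire → α → ℕ} (hf : CRel f) (hg : CRel g) :
    CRel fun p a => Nat.pair (f p a) (g p a) :=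
  map₂ Primrec₂.natPair.to_comp hf hg

theorem unpair_fst {f : Baire → α → ℕ} (hf : CRel f) : CRel fun p a => (Nat.unpair (f p a)).1 :=
  fst.comp (map Primrec.unpair.to_comp hf)

theorem unpair_snd {f : Baire → α → ℕ} (hf : CRel f) : CRel fun p a => (Nat.unpair (f p a)).2 :=
  snd.comp (map Primrec.unpair.to_comp hf)

theorem get {f : Baire → α → ℕ} (hf : CRel f) : CRel fun p a => p (f p a) := oracle.comp hf

/-- Prefixes of the zero oracle are computable, so one searches for the first that yields an answer.
For functions that ignore the oracle, this turns the calculus back into ordinary computability. -/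
theorem computable {f : Baire → α → σ} (hf : CRel f) : Computable (f fun _ => 0) := by
  obtain ⟨φ, hφ⟩ := hf
  have hw : Computable₂ fun (a : α) (m : ℕ) => φ (word (fun _ => 0) m, a) := by
    have h1 : Primrec fun m : ℕ => (List.range m).map fun _ => 0 :=
      Primrec.list_map Primrec.list_range (Primrec₂.const 0)
    exact hφ.computable.comp ((h1.to_comp.comp Computable.snd).pair Computable.fst)
  refine (Partrec.rfindOpt hw).of_eq_tot fun a => ?_
  obtain ⟨m, hm⟩ := hφ.total (fun _ => 0) a
  have hdom : (Nat.rfindOpt fun m => φ (word (fun _ => 0) m, a)).Dom :=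
    Nat.rfindOpt_dom.2 ⟨m, _, hm⟩
  obtain ⟨b, hb⟩ := Part.dom_iff_mem.1 hdom
  obtain ⟨n, hn⟩ := Nat.rfindOpt_spec hb
  rwa [hφ.sound hn] at hb

end CRel

/-- A total functional on Baire space, computable with all its values. -/
def CFun (F : Baire → Baire) : Prop := CRel fun p (n : ℕ) => F p n

/-- `u`, followed by the value that `φ` computes from `w` for the next entry, if there is one. -/
def outStep (φ : List ℕ × ℕ → Option ℕ) (w u : List ℕ) : List ℕ :=
  Option.casesOn (φ (w, u.length)) u fun v => u ++ [v]

theorem outStep_none {φ : List ℕ × ℕ → Option ℕ} {w u : List ℕ} (h : φ (w, u.length) = none) :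
    outStep φ w u = u := by simp only [outStep, h]

theorem outStep_some {φ : List ℕ × ℕ → Option ℕ} {w u : List ℕ} {v : ℕ}
    (h : φ (w, u.length) = some v) : outStep φ w u = u ++ [v] := by simp only [outStep, h]

/-- The entries computed by `φ` from `w` until the first failure, at most `|w|` many. -/
def outWord (φ : List ℕ × ℕ → Option ℕ) (w : List ℕ) : List ℕ :=
  Nat.rec [] (fun _ u => outStep φ w u) w.length

theorem computable_outWord {φ : List ℕ × ℕ → Option ℕ} (hφ : Computable φ) :
    Computable (outWord φ) := by
  refine Computable.nat_rec (h := fun w (x : ℕ × List ℕ) => outStep φ w x.2)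
    Computable.list_length (Computable.const []) (Computable₂.mk ?_)
  have h2 : Computable fun t : List ℕ × ℕ × List ℕ => t.2.2 := Computable.snd.comp Computable.snd
  refine Computable.option_casesOn (g := fun (t : List ℕ × ℕ × List ℕ) (v : ℕ) => t.2.2 ++ [v])
    (hφ.comp (Computable.fst.pair (Computable.list_length.comp h2))) h2 (Computable₂.mk ?_)
  exact Computable.list_concat.comp (h2.comp Computable.fst) Computable.snd

/-- The last clause is maximality: the output stays shorter than the input only if `φ` fails at the
next entry. Monotonicity and unbounded growth of the output both follow from it. -/
theorem outWord_spec (φ : List ℕ × ℕ → Option ℕ) (w : List ℕ) :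
    (∀ j v, (outWord φ w)[j]? = some v → φ (w, j) = some v) ∧
      (outWord φ w).length ≤ w.length ∧
      ((outWord φ w).length = w.length ∨ φ (w, (outWord φ w).length) = none) := by
  unfold outWord
  induction w.length with
  | zero => simp
  | succ k ih =>
    dsimp only
    generalize (Nat.rec [] (fun _ u => outStep φ w u) k : List ℕ) = u at ih ⊢
    obtain ⟨h1, h2, h3⟩ := ih
    cases h : φ (w, u.length) with
    | none =>
      rw [outStep_none h]
      exact ⟨h1, by omega, Or.inr h⟩
    | some v =>
      have h4 : u.length = k := by simpa [h] using h3
      rw [outStep_some h]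
      refine ⟨fun j v' hj => ?_, by simp [h4], Or.inl (by simp [h4])⟩
      rw [List.getElem?_append] at hj
      split_ifs at hj with hlt
      · exact h1 _ _ hj
      · have : j = u.length := by
          by_contra hne
          rw [List.getElem?_eq_none (by simp; omega)] at hj
          simp at hj
        subst this
        simp at hj
        rw [h, hj]

/-- If the longer input gave the shorter output, `φ` would fail on `w` at a position where it
succeeds on the prefix `v`. -/
theorem outWord_mono {φ : List ℕ × ℕ → Option ℕ}
    (hmono : ∀ v w a b, v <+: w → φ (v, a) = some b → φ (w, a) = some b) {v w : List ℕ}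
    (hvw : v <+: w) : outWord φ v <+: outWord φ w := by
  obtain ⟨h1, h2, -⟩ := outWord_spec φ v
  obtain ⟨h1', -, h3'⟩ := outWord_spec φ w
  have hlen : (outWord φ v).length ≤ (outWord φ w).length := by
    by_contra! hlt
    have h4 := hvw.length_le
    have h5 : φ (w, (outWord φ w).length) = none := h3'.resolve_left (by omega)
    have h6 := hmono _ _ _ _ hvw (h1 _ _ (List.getElem?_eq_getElem hlt))
    simp [h5] at h6
  rw [List.prefix_iff_getElem?]
  intro j hj
  have h6 := hmono _ _ _ _ hvw (h1 _ _ (List.getElem?_eq_getElem hj))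
  have h7 := h1' _ _ (List.getElem?_eq_getElem (hj.trans_le hlen))
  rw [List.getElem?_eq_getElem (hj.trans_le hlen), ← h7, h6]

theorem Approximates.outWord_eq {φ : List ℕ × ℕ → Option ℕ} {F : Baire → Baire}
    (h : Approximates φ F) (p : Baire) (m : ℕ) :
    outWord φ (word p m) = word (F p) (outWord φ (word p m)).length := by
  refine List.ext_getElem (by simp [word]) fun j h1 h2 => ?_
  have := h.sound ((outWord_spec φ (word p m)).1 j _ (List.getElem?_eq_getElem h1))
  rw [this]
  simp [word]

theorem Approximates.le_length_outWord {φ : List ℕ × ℕ → Option ℕ} {F : Baire → Baire}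
    (h : Approximates φ F) (p : Baire) (n : ℕ) :
    ∀ᶠ m in atTop, n ≤ (outWord φ (word p m)).length := by
  have : ∀ᶠ m in atTop, ∀ j ∈ Finset.range n, φ (word p m, j) = some (F p j) :=
    (Finset.eventually_all _).2 fun j _ => h.eventually p j
  filter_upwards [this, eventually_ge_atTop n] with m h1 h2
  by_contra! hlt
  have h3 := (outWord_spec φ (word p m)).2.2
  rw [length_word, h1 _ (Finset.mem_range.2 hlt)] at h3
  rcases h3 with h3 | h3
  · omega
  · simp at h3

/-- The output words of `F` are prefixes of `F p`, so they can serve as the oracle prefixes for `f`.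
-/
theorem CRel.subst {f : Baire → α → σ} {F : Baire → Baire} (hf : CRel f) (hF : CFun F) :
    CRel fun p a => f (F p) a := by
  obtain ⟨φ, hφ⟩ := hf
  obtain ⟨ψ, hψ⟩ := hF
  refine ⟨fun x => φ (outWord ψ x.1, x.2), ?_, ?_, ?_⟩
  · exact hφ.computable.comp
      (((computable_outWord hψ.computable).comp Computable.fst).pair Computable.snd)
  · intro v w a b hvw h
    exact hφ.mono _ _ _ _ (outWord_mono hψ.mono hvw) h
  · intro p a
    obtain ⟨n, hn⟩ := hφ.total (F p) a
    obtain ⟨m, hm⟩ := (hψ.le_length_outWord p n).exists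
    refine ⟨m, ?_⟩
    dsimp only
    rw [hψ.outWord_eq]
    exact hφ.mono _ _ _ _ (word_prefix _ hm) hn

end Relative

/-! ### Total computable functionals: closure, computability and continuity -/

namespace CFun

theorem comp {F G : Baire → Baire} (hF : CFun F) (hG : CFun G) : CFun fun p => F (G p) :=
  CRel.subst hF hG

theorem fstB : CFun fstB := CRel.unpair_fst CRel.oracle

theorem sndB : CFun sndB := CRel.unpair_snd CRel.oracle

theorem pairB {F G : Baire → Baire} (hF : CFun F) (hG : CFun G) :
    CFun fun p => pairB (F p) (G p) := CRel.natPair hF hG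

theorem computableBaire {F : Baire → Baire} (hF : CFun F) :
    ComputableBaire fun p => Part.some (F p) := by
  obtain ⟨φ, hφ⟩ := hF
  refine ⟨outWord φ, computable_outWord hφ.computable, fun _ _ => outWord_mono hφ.mono,
    fun p q => ?_⟩
  rw [Part.mem_some_iff]
  constructor
  · rintro rfl n
    obtain ⟨m, hm⟩ := (hφ.le_length_outWord p n).exists
    exact ⟨m, by rw [hφ.outWord_eq]; exact word_prefix _ hm⟩
  · intro h
    funext n
    obtain ⟨m, hm⟩ := h (n + 1)
    rw [hφ.outWord_eq] at hm
    have h1 := List.prefix_iff_getElem?.1 hm n (by simp [word])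
    have h2 := hm.length_le
    rw [length_word, length_word] at h2
    rw [List.getElem?_eq_getElem (by rw [length_word]; omega)] at h1
    simpa [word] using h1.symm

/-- Each output entry is fixed by a finite prefix of the input, hence locally constant. -/
theorem continuous {F : Baire → Baire} (hF : CFun F) : Continuous F := by
  obtain ⟨φ, hφ⟩ := hF
  refine continuous_pi fun n => continuous_iff_continuousAt.2 fun p => ?_
  obtain ⟨m, hm⟩ := hφ.total p n
  have h : ∀ᶠ q in 𝓝 p, ∀ i ∈ Finset.range m, q i = p i :=
    (Finset.eventually_all _).2 fun i _ =>
      (continuous_apply i).continuousAt.eventually ((isOpen_discrete {p i}).mem_nhds rfl)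
  refine (continuousAt_const (y := F p n)).congr ?_
  filter_upwards [h] with q hq
  rw [← (word_eq_iff q p m).2 fun i hi => hq i (Finset.mem_range.2 hi)] at hm
  exact hφ.sound hm

end CFun

/-! ### Names of functions -/

/-- A code of a function sees `q` only through a finite word; with the oracle `a` this is enough to
rebuild a prefix of the paired input. -/
theorem word_pairB (a q : Baire) (m : ℕ) :
    (List.range (word q m).length).map (fun k => Nat.pair (a k) ((word q m).getD k 0)) =
      word (pairB a q) m := by
  rw [length_word, word, word, List.map_inj_left]
  intro k hk
  have hk : k < m := by simpa using hk
  simp [pairB, hk]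

/-- The parametrization theorem: a code of `f (pairB a ·)` is computable from `a`. -/
theorem exists_code {f : Baire → Baire} (hf : CFun f) :
    ∃ S : Baire → Baire, CFun S ∧ ∀ a q, f (pairB a q) ∈ eta (S a) q := by
  obtain ⟨φ, hφ⟩ := hf
  let zip : Baire → ℕ × List ℕ → List ℕ := fun a x =>
    (List.range x.2.length).map fun k => Nat.pair (a k) (x.2.getD k 0)
  -- The convention of `eta`: a value `v` is stored as `v + 1`, and `0` asks for a longer prefix.
  let S' : Baire → ℕ × List ℕ → ℕ := fun a x => ((φ (zip a x, x.1)).map Nat.succ).getD 0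
  have hzip : CRel zip := by
    refine CRel.tabulate (f := fun a (y : (ℕ × List ℕ) × ℕ) =>
      Nat.pair (a y.2) (y.1.2.getD y.2 0)) (CRel.map Computable.list_length CRel.snd) ?_
    exact CRel.natPair (CRel.get CRel.snd)
      (CRel.map₂ (g := fun (l : List ℕ) n => l.getD n 0) (Primrec.list_getD 0).to_comp
        (CRel.snd.comp CRel.fst) CRel.snd)
  have hS' : CRel S' := by
    refine CRel.map (g := fun o : Option ℕ => (o.map Nat.succ).getD 0) ?_
      (CRel.map hφ.computable (hzip.pair CRel.fst))
    exact Computable.option_getD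
      (Computable.option_map Computable.id (Computable.succ.comp Computable.snd).to₂)
      (Computable.const 0)
  refine ⟨fun a c => S' a (Denumerable.ofNat (ℕ × List ℕ) c),
    hS'.comp (CRel.of_computable (Computable.ofNat _)), fun a q => ?_⟩
  have hS : ∀ n m, S' a (n, word q m) = ((φ (word (pairB a q) m, n)).map Nat.succ).getD 0 := by
    intro n m
    simp only [S', zip, word_pairB]
  have hdom : ∀ n : ℕ, ∃ m, S' a (Denumerable.ofNat (ℕ × List ℕ)
      (Encodable.encode (n, word q m))) ≠ 0 := by
    intro n
    obtain ⟨m, hm⟩ := hφ.total (pairB a q) n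
    exact ⟨m, by simp [hS, hm]⟩
  refine ⟨hdom, funext fun n => ?_⟩
  have h := Nat.find_spec (hdom n)
  change S' a (Denumerable.ofNat (ℕ × List ℕ)
      (Encodable.encode (n, word q (Nat.find (hdom n))))) - 1 = _
  generalize Nat.find (hdom n) = m at h ⊢
  rw [Denumerable.ofNat_encode, hS] at h ⊢
  cases hv : φ (word (pairB a q) m, n) with
  | none => simp [hv] at h
  | some v => simpa using hφ.sound hv

/-- A sequence with an entry `0` exactly if `η_a` gives a value at `q` with an entry `0`. -/
def hit (r : Baire) : Baire := fun c =>
  -- Here `c` codes a position `n` and a prefix length `m`. The answer `1` encodes the value `0`;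
  -- the vanishing sum says that no shorter prefix was answered, so that this is the answer `eta`
  -- uses.
  if fstB r (Encodable.encode (c.unpair.1, word (sndB r) c.unpair.2)) = 1 ∧
      ∑ m ∈ Finset.range c.unpair.2,
        fstB r (Encodable.encode (c.unpair.1, word (sndB r) m)) = 0
  then 0 else 1

theorem cfun_hit : CFun hit := by
  have hw : CRel fun (r : Baire) (x : ℕ × ℕ) =>
      fstB r (Encodable.encode (x.1, word (sndB r) x.2)) := by
    have h1 : CRel fun (r : Baire) (x : ℕ × ℕ) => word (sndB r) x.2 :=
      CRel.tabulate (f := fun r (y : (ℕ × ℕ) × ℕ) => sndB r y.2) CRel.snd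
        (CRel.comp (f := fun r n => sndB r n) CFun.sndB CRel.snd)
    exact CRel.comp (f := fun r n => fstB r n) CFun.fstB
      (CRel.map Computable.encode (CRel.fst.pair h1))
  have h1 : CRel fun (_ : Baire) (c : ℕ) => c.unpair.1 := CRel.unpair_fst CRel.id
  have h2 : CRel fun (_ : Baire) (c : ℕ) => c.unpair.2 := CRel.unpair_snd CRel.id
  refine CRel.ite (CRel.decide_and (CRel.decide_eq (hw.comp (h1.pair h2)) (CRel.const 1))
    (CRel.decide_eq ?_ (CRel.const 0))) (CRel.const 0) (CRel.const 1)
  exact CRel.sum (f := fun r (y : ℕ × ℕ) =>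
    fstB r (Encodable.encode (y.1.unpair.1, word (sndB r) y.2))) h2
    (hw.comp ((h1.comp CRel.fst).pair CRel.snd))

theorem hit_iff {a q r : Baire} (h : r ∈ eta a q) :
    (∃ c, hit (pairB a q) c = 0) ↔ ∃ n, r n = 0 := by
  classical
  obtain ⟨hdom, rfl⟩ := h
  simp only [eta, hit, fstB_pairB, sndB_pairB, ite_eq_left_iff, one_ne_zero, imp_false, not_not,
    Finset.sum_eq_zero_iff, Finset.mem_range]
  constructor
  · rintro ⟨c, h1, h2⟩
    refine ⟨c.unpair.1, ?_⟩
    have : Nat.find (hdom c.unpair.1) = c.unpair.2 := by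
      rw [Nat.find_eq_iff]
      exact ⟨by rw [h1]; exact one_ne_zero, fun m hm => not_not.2 (h2 m hm)⟩
    rw [this, h1]
  · rintro ⟨n, hn⟩
    refine ⟨Nat.pair n (Nat.find (hdom n)), ?_, ?_⟩
    · have := Nat.find_spec (hdom n)
      simp only [Nat.unpair_pair]
      omega
    · intro m hm
      rw [Nat.unpair_pair] at hm ⊢
      simpa using Nat.find_min (hdom n) hm

/-! ### Names of closed sets -/

section Closed

variable {X : Type*} {δ : BaireRep X}

theorem hit_closedRep {a q : Baire} {A : ClosedSets δ} {x : X} (hA : (closedRep δ).names a A)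
    (hq : δ.names q x) : (∃ c, hit (pairB a q) c = 0) ↔ x ∉ A.1 := by
  obtain ⟨r, hr, y, rfl, hy⟩ := hA q x hq ⟨_, rfl⟩
  exact (hit_iff hr).trans hy.symm

/-- A set whose complement is recognized by a computable functional with parameter is closed, and
a name of it is computable from the parameter. -/
theorem exists_closedRep {f : Baire → Baire} (hf : CFun f) :
    ∃ S : Baire → Baire, CFun S ∧ ∀ (X : Type*) (δ : BaireRep X) (a : Baire) (B : Set X),
      (∀ q x, δ.names q x → ((∃ c, f (pairB a q) c = 0) ↔ x ∉ B)) →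
        ∃ B' : ClosedSets δ, B'.1 = B ∧ (closedRep δ).names (S a) B' := by
  obtain ⟨S, hS, hSf⟩ := exists_code hf
  refine ⟨S, hS, fun X δ a B hB => ?_⟩
  have hc : ContinuousMapRep δ sierpinskiRep (fun x => x ∈ Bᶜ) := by
    refine ⟨fun q => Part.some (f (pairB a q)), ?_, ?_⟩
    · have : Continuous fun q => f (pairB a q) := by
        refine hf.continuous.comp (continuous_pi fun n => ?_)
        exact (continuous_of_discreteTopology (f := fun k => Nat.pair (a n) k)).comp
          (continuous_apply n)
      exact this.comp continuous_subtype_val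
    · exact fun q x hq _ => ⟨_, Part.mem_some _, _, rfl, (hB q x hq).symm⟩
  exact ⟨⟨B, hc⟩, rfl, fun q x hq _ => ⟨_, hSf a q, _, rfl, (hB q x hq).symm⟩⟩

end Closed

/-! ### Reductions by total functionals -/

/-- A Weihrauch reduction by total computable functionals, stated pointwise. -/
def TotalReduction {X Y U V : Type*} {δX : BaireRep X} {δY : BaireRep Y}
    {δU : BaireRep U} {δV : BaireRep V} (f : MultiFun δX δY) (g : MultiFun δU δV) : Prop :=
  ∃ K H : Baire → Baire, CFun K ∧ CFun H ∧ ∀ p x, δX.names p x → (f.val x).Nonempty →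
    ∃ u, δU.names (H p) u ∧ (g.val u).Nonempty ∧
      ∀ r, ∀ v ∈ g.val u, δV.names r v → ∃ y ∈ f.val x, δY.names (K (pairB p r)) y

namespace TotalReduction

variable {X Y U V S T : Type*} {δX : BaireRep X} {δY : BaireRep Y} {δU : BaireRep U}
  {δV : BaireRep V} {δS : BaireRep S} {δT : BaireRep T}
  {f : MultiFun δX δY} {g : MultiFun δU δV} {h : MultiFun δS δT}

theorem weihrauchLE (hfg : TotalReduction f g) : WeihrauchLE f g := by
  obtain ⟨K, H, hK, hH, hred⟩ := hfg
  refine ⟨_, _, hK.computableBaire, hH.computableBaire, fun G hG p x hp hx => ?_⟩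
  obtain ⟨u, hu, hne, hr⟩ := hred p x hp hx
  obtain ⟨r, hrG, v, hv, hrv⟩ := hG _ u hu hne
  obtain ⟨y, hy, hKy⟩ := hr r v hv hrv
  refine ⟨K (pairB p r), ?_, y, hy, hKy⟩
  exact Part.mem_bind (Part.mem_some _) (Part.mem_bind hrG (Part.mem_some _))

theorem trans (hfg : TotalReduction f g) (hgh : TotalReduction g h) : TotalReduction f h := by
  obtain ⟨K₁, H₁, hK₁, hH₁, hr₁⟩ := hfg
  obtain ⟨K₂, H₂, hK₂, hH₂, hr₂⟩ := hgh
  refine ⟨fun z => K₁ (pairB (fstB z) (K₂ (pairB (H₁ (fstB z)) (sndB z)))), fun p => H₂ (H₁ p),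
    hK₁.comp (CFun.fstB.pairB (hK₂.comp ((hH₁.comp CFun.fstB).pairB CFun.sndB))),
    hH₂.comp hH₁, fun p x hp hx => ?_⟩
  obtain ⟨u, hu, hune, hur⟩ := hr₁ p x hp hx
  obtain ⟨s, hs, hsne, hsr⟩ := hr₂ _ u hu hune
  refine ⟨s, hs, hsne, fun r t ht hrt => ?_⟩
  obtain ⟨v, hv, hKv⟩ := hsr r t ht hrt
  simpa only [fstB_pairB, sndB_pairB] using hur _ v hv hKv

end TotalReduction

/-- Closed choice is transferred along a partial map `e` from `D` onto `Y`, computed by `E`, whose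
domain is closed, with the complement recognized by `R`. -/
theorem closedChoice_reduction {X Y : Type*} {δX : BaireRep X} {δY : BaireRep Y} {D : Set X}
    {e : X → Y} {E R : Baire → Baire} (hE : CFun E) (hR : CFun R)
    (hDR : ∀ q x, δX.names q x → ((∃ c, R q c = 0) ↔ x ∉ D))
    (hDE : ∀ q, ∀ x ∈ D, δX.names q x → δY.names (E q) (e x)) (hsurj : ∀ y, ∃ x ∈ D, e x = y) :
    TotalReduction (closedChoice δY) (closedChoice δX) := by
  -- A product vanishes if and only if a factor does, and the pairing of positions runs both
  -- searches in parallel.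
  let f : Baire → Baire := fun r n =>
    R (sndB r) n.unpair.1 * hit (pairB (fstB r) (E (sndB r))) n.unpair.2
  have hf : CFun f :=
    CRel.mul (CRel.comp (f := fun r n => R (sndB r) n) (hR.comp CFun.sndB) (CRel.unpair_fst CRel.id))
      (CRel.comp (f := fun r n => hit (pairB (fstB r) (E (sndB r))) n)
        (cfun_hit.comp (CFun.fstB.pairB (hE.comp CFun.sndB))) (CRel.unpair_snd CRel.id))
  obtain ⟨S, hS, hSf⟩ := exists_closedRep hf
  refine ⟨fun z => E (sndB z), S, hE.comp CFun.sndB, hS, fun p A hA hne => ?_⟩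
  obtain ⟨B, hB, hSB⟩ := hSf X δX p (D ∩ e ⁻¹' A.1) fun q x hq => by
    have h1 : (∃ c, f (pairB p q) c = 0) ↔
        (∃ c, R q c = 0) ∨ ∃ c, hit (pairB p (E q)) c = 0 := by
      simp only [f, sndB_pairB, fstB_pairB, mul_eq_zero]
      constructor
      · rintro ⟨c, h | h⟩
        exacts [Or.inl ⟨_, h⟩, Or.inr ⟨_, h⟩]
      · rintro (⟨c, h⟩ | ⟨c, h⟩)
        exacts [⟨Nat.pair c 0, by simp [h]⟩, ⟨Nat.pair 0 c, by simp [h]⟩]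
    rw [h1, hDR q x hq]
    -- Outside `D` the value `E q` need not be a name and `hit` may answer anything, but `R` already
    -- rejects `x`.
    by_cases hx : x ∈ D
    · rw [hit_closedRep hA (hDE q x hx hq)]
      simp [hx]
    · simp [hx]
  refine ⟨B, hSB, ?_, fun r x hx hr => ?_⟩
  · obtain ⟨y, hy⟩ := hne
    obtain ⟨x, hx, rfl⟩ := hsurj y
    exact ⟨x, hB.ge ⟨hx, hy⟩⟩
  · have hx' : x ∈ D ∩ e ⁻¹' A.1 := hB.le hx
    refine ⟨e x, hx'.2, ?_⟩
    dsimp only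
    rw [sndB_pairB]
    exact hDE r x hx'.1 hr

/-- Closed choice is transferred along a computable surjection. -/
theorem closedChoice_reduction_of_surjective {X Y : Type*} {δX : BaireRep X} {δY : BaireRep Y}
    {e : X → Y} {E : Baire → Baire} (hE : CFun E)
    (hEe : ∀ q x, δX.names q x → δY.names (E q) (e x)) (hsurj : Function.Surjective e) :
    TotalReduction (closedChoice δY) (closedChoice δX) :=
  closedChoice_reduction (D := univ) (R := fun _ _ => 1) hE (CRel.const 1) (by simp)
    (fun q x _ => hEe q x) fun y => (hsurj y).imp fun _ h => ⟨mem_univ _, h⟩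

/-! ### Closed choice on products -/

/-- A pair lies outside `A₁ ×ˢ A₂` once one component is rejected, and a point of the product
already answers both questions. -/
theorem closedChoice_prod_reduction {X Y : Type*} (δX : BaireRep X) (δY : BaireRep Y) :
    TotalReduction ((closedChoice δX).prod (closedChoice δY))
      (closedChoice (prodRep δX δY)) := by
  let f : Baire → Baire := fun r n =>
    hit (pairB (fstB (fstB r)) (fstB (sndB r))) n.unpair.1 *
      hit (pairB (sndB (fstB r)) (sndB (sndB r))) n.unpair.2
  have hf : CFun f :=
    CRel.mul
      (CRel.comp (f := fun r n => hit (pairB (fstB (fstB r)) (fstB (sndB r))) n)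
        (cfun_hit.comp ((CFun.fstB.comp CFun.fstB).pairB (CFun.fstB.comp CFun.sndB)))
        (CRel.unpair_fst CRel.id))
      (CRel.comp (f := fun r n => hit (pairB (sndB (fstB r)) (sndB (sndB r))) n)
        (cfun_hit.comp ((CFun.sndB.comp CFun.fstB).pairB (CFun.sndB.comp CFun.sndB)))
        (CRel.unpair_snd CRel.id))
  obtain ⟨S, hS, hSf⟩ := exists_closedRep hf
  refine ⟨sndB, S, CFun.sndB, hS, fun p A hA hne => ?_⟩
  obtain ⟨B, hB, hSB⟩ := hSf (X × Y) (prodRep δX δY) p (A.1.1 ×ˢ A.2.1) fun q x hq => by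
    have h1 : (∃ c, f (pairB p q) c = 0) ↔
        (∃ c, hit (pairB (fstB p) (fstB q)) c = 0) ∨
          ∃ c, hit (pairB (sndB p) (sndB q)) c = 0 := by
      simp only [f, sndB_pairB, fstB_pairB, mul_eq_zero]
      constructor
      · rintro ⟨c, h | h⟩
        exacts [Or.inl ⟨_, h⟩, Or.inr ⟨_, h⟩]
      · rintro (⟨c, h⟩ | ⟨c, h⟩)
        exacts [⟨Nat.pair c 0, by simp [h]⟩, ⟨Nat.pair 0 c, by simp [h]⟩]
    rw [h1, hit_closedRep hA.1 hq.1, hit_closedRep hA.2 hq.2, mem_prod, not_and_or]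
  refine ⟨B, hSB, ?_, fun r v hv hr => ⟨v, hB.le hv, ?_⟩⟩
  · exact hne.mono hB.ge
  · rwa [sndB_pairB]

/-- A semi-decidable property of Baire space is the union of a computable sequence of properties
of prefixes. -/
theorem exists_prefix_test {f : Baire → Baire} (hf : CFun f) :
    ∃ t : List ℕ → ℕ, Computable t ∧ (∀ v w, v <+: w → t w = 0 → t v = 0) ∧ t [] = 0 ∧
      ∀ r, (∃ c, f r c = 0) ↔ ∃ n, t (word r n) ≠ 0 := by
  obtain ⟨φ, hφ⟩ := hf
  -- Counts the positions below `z.length` at which `φ` has already produced a `0`. An undefined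
  -- value defaults to `1` and is not counted.
  let T : Baire → List ℕ → ℕ := fun _ z =>
    ∑ c ∈ Finset.range z.length, if (φ (z, c)).getD 1 = 0 then 1 else 0
  have hT : CRel T := by
    refine CRel.sum (f := fun _ (y : List ℕ × ℕ) => if (φ (y.1, y.2)).getD 1 = 0 then 1 else 0)
      (CRel.of_computable Computable.list_length) (CRel.ite (CRel.decide_eq ?_ (CRel.const 0))
      (CRel.const 1) (CRel.const 0))
    exact CRel.of_computable (Computable.option_getD hφ.computable (Computable.const 1))
  have hT0 : ∀ p z, T p z = 0 ↔ ∀ c < z.length, φ (z, c) ≠ some 0 := by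
    intro p z
    simp only [T, Finset.sum_eq_zero_iff, Finset.mem_range, ite_eq_right_iff, one_ne_zero,
      imp_false]
    refine forall₂_congr fun c _ => not_congr ?_
    cases φ (z, c) <;> simp
  refine ⟨T fun _ => 0, hT.computable, fun v w hvw => ?_, ?_, fun r => ?_⟩
  · simp only [hT0]
    exact fun h c hc hv => h c (hc.trans_le hvw.length_le) (hφ.mono _ _ _ _ hvw hv)
  · simp [hT0]
  · simp only [ne_eq, hT0, not_forall, not_not, length_word]
    constructor
    · rintro ⟨c, hc⟩
      obtain ⟨m, hm, hcm⟩ := ((hφ.eventually r c).and (eventually_gt_atTop c)).exists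
      exact ⟨m, c, hcm, by rw [hm, hc]⟩
    · rintro ⟨n, c, -, hc⟩
      exact ⟨c, (hφ.sound hc).symm⟩

/-- A choice of infinite branches that also works for finite trees: `P y n` says that the prefix of
`y` of length `n` belongs to the tree. -/
theorem exists_branch {P : (ℕ → Bool) → ℕ → Prop}
    (hloc : ∀ n y y', (∀ k < n, y k = y' k) → P y n → P y' n)
    (hanti : ∀ y m n, m ≤ n → P y n → P y m) (h0 : ∀ y, P y 0) :
    ∃ y, ∀ n, (∃ y', P y' n) → P y n := by
  classical
  -- With all levels non-empty this is Kőnig's lemma, by compactness of Cantor space.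
  by_cases h : ∀ n, ∃ y, P y n
  · have hcl : ∀ n, IsClosed {y | P y n} := by
      intro n
      have : {y | P y n} =
          (fun (y : ℕ → Bool) (k : Fin n) => y k) ⁻¹' {u | ∃ y, (∀ k : Fin n, y k = u k) ∧ P y n} := by
        ext y
        constructor
        · exact fun hy => ⟨y, fun _ => rfl, hy⟩
        · rintro ⟨y', h1, h2⟩
          exact hloc n y' y (fun k hk => h1 ⟨k, hk⟩) h2
      rw [this]
      exact (isClosed_discrete _).preimage (continuous_pi fun k => continuous_apply _)
    obtain ⟨y, hy⟩ := IsCompact.nonempty_iInter_of_sequence_nonempty_isCompact_isClosed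
      (fun n => {y | P y n}) (fun n y hy => hanti y n (n + 1) n.le_succ hy) h
      (hcl 0).isCompact hcl
    exact ⟨y, fun n _ => mem_iInter.1 hy n⟩
  · push Not at h
    obtain ⟨N, hN, hmin⟩ : ∃ N, (∀ y, ¬ P y N) ∧ ∀ m < N, ∃ y, P y m := by
      refine ⟨Nat.find h, Nat.find_spec h, fun m hm => ?_⟩
      simpa using Nat.find_min h hm
    cases N with
    | zero => exact absurd (h0 fun _ => false) (hN _)
    | succ N =>
      obtain ⟨y, hy⟩ := hmin N N.lt_succ_self
      refine ⟨y, fun n ⟨y', hy'⟩ => hanti _ _ _ ?_ hy⟩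
      by_contra! hlt
      exact hN y' (hanti _ _ _ hlt hy')

/-- The canonical name of `(i, y)`. -/
def natCantorName (i : ℕ) (y : ℕ → Bool) : Baire := pairB (fun _ => i) fun k => (y k).toNat

theorem natCantorName_names (i : ℕ) (y : ℕ → Bool) :
    (prodRep natRep cantorRep).names (natCantorName i y) (i, y) :=
  ⟨by rw [natCantorName, fstB_pairB]; rfl, by rw [natCantorName, sndB_pairB]; exact fun _ => rfl⟩

/-- For each `i` the prefixes not yet rejected form a binary tree whose infinite branches are the
section of `A` at `i`. The first instance picks an `i` with no empty level, the second a sequence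
for every `i` simultaneously; the sequence for the picked `i` is a branch. -/
theorem closedChoice_natCantor_reduction :
    TotalReduction (closedChoice (prodRep natRep cantorRep))
      ((closedChoice natRep).prod (closedChoice cantorRep)) := by
  obtain ⟨t, ht, htmono, ht0, htest⟩ := exists_prefix_test cfun_hit
  -- `OK p i y n`: at stage `n`, the point `(i, y)` is not yet known to be outside of the set
  let OK : Baire → ℕ → (ℕ → Bool) → ℕ → Prop := fun p i y n =>
    t (word (pairB p (natCantorName i y)) n) = 0
  -- The binary digits of `u.2.1` serve as the Cantor prefix, so the words of length `n` are indexed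
  -- by the numbers below `2 ^ n`.
  let W : Baire → ℕ × ℕ × ℕ → List ℕ := fun p u =>
    (List.range u.2.2).map fun k => Nat.pair (p k) (Nat.pair u.1 (u.2.1 / 2 ^ k % 2))
  have hW : CRel W := by
    refine CRel.tabulate (f := fun p (y : (ℕ × ℕ × ℕ) × ℕ) =>
      Nat.pair (p y.2) (Nat.pair y.1.1 (y.1.2.1 / 2 ^ y.2 % 2))) (CRel.snd.comp CRel.snd) ?_
    exact CRel.natPair (CRel.get CRel.snd) (CRel.natPair (CRel.fst.comp CRel.fst)
      (CRel.mod (CRel.div (CRel.fst.comp (CRel.snd.comp CRel.fst))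
        (CRel.pow (CRel.const 2) CRel.snd)) (CRel.const 2)))
  have hWeq : ∀ p i x n, W p (i, x, n) = word (pairB p (natCantorName i x.testBit)) n := by
    intro p i x n
    simp [W, word, pairB, natCantorName, Nat.toNat_testBit]
  -- Zero exactly if some word survives on level `u.2`: emptiness of a level is decidable because
  -- the level is finite.
  let g : Baire → ℕ × ℕ → ℕ := fun p u => ∏ x ∈ Finset.range (2 ^ u.2), t (W p (u.1, x, u.2))
  have hg : CRel g :=
    CRel.prod (f := fun p (y : (ℕ × ℕ) × ℕ) => t (W p (y.1.1, y.2, y.1.2)))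
      (CRel.pow (CRel.const 2) CRel.snd)
      (CRel.map ht (hW.comp ((CRel.fst.comp CRel.fst).pair
        (CRel.snd.pair (CRel.snd.comp CRel.fst)))))
  have hloc : ∀ p i n y y', (∀ k < n, y k = y' k) → OK p i y n → OK p i y' n := by
    intro p i n y y' h
    have : word (pairB p (natCantorName i y)) n = word (pairB p (natCantorName i y')) n :=
      (word_eq_iff _ _ _).2 fun k hk => by simp [pairB, natCantorName, h k hk]
    simp only [OK, this]
    exact fun h => h
  have hanti : ∀ p i y m n, m ≤ n → OK p i y n → OK p i y m :=
    fun p i y m n hmn => htmono _ _ (word_prefix _ hmn)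
  have hgOK : ∀ p i n, g p (i, n) = 0 ↔ ∃ y, OK p i y n := by
    intro p i n
    simp only [g, Finset.prod_eq_zero_iff, Finset.mem_range, hWeq]
    constructor
    · rintro ⟨x, -, hx⟩
      exact ⟨_, hx⟩
    · rintro ⟨y, hy⟩
      refine ⟨Nat.ofBits fun k : Fin n => y k, Nat.ofBits_lt_two_pow _, ?_⟩
      refine hloc p i n y _ (fun k hk => ?_) hy
      rw [Nat.testBit_ofBits_lt _ _ hk]
  -- Rejects an integer as soon as one level of its tree is empty.
  let f₁ : Baire → Baire := fun r n => 1 - g (fstB r) (sndB r 0, n)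
  have hf₁ : CFun f₁ :=
    CRel.sub (CRel.const 1) (CRel.comp (f := fun r (u : ℕ × ℕ) => g (fstB r) u)
      (hg.subst CFun.fstB)
      ((CRel.comp (f := fun r n => sndB r n) CFun.sndB (CRel.const 0)).pair CRel.id))
  -- Zero if and only if both summands vanish: the level has a node, yet the sequence encoded for
  -- this index leaves the tree there.
  let f₂ : Baire → Baire := fun r c => g (fstB r) (c.unpair.1, c.unpair.2) +
    (1 - t ((List.range c.unpair.2).map fun k =>
      Nat.pair (fstB r k) (Nat.pair c.unpair.1 (sndB r (Nat.pair c.unpair.1 k)))))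
  have h1 : CRel fun (_ : Baire) (c : ℕ) => c.unpair.1 := CRel.unpair_fst CRel.id
  have h2 : CRel fun (_ : Baire) (c : ℕ) => c.unpair.2 := CRel.unpair_snd CRel.id
  have hf₂ : CFun f₂ := by
    refine CRel.add (CRel.comp (f := fun r (u : ℕ × ℕ) => g (fstB r) u)
      (hg.subst CFun.fstB) (h1.pair h2)) (CRel.sub (CRel.const 1) (CRel.map ht ?_))
    refine CRel.tabulate (f := fun r (y : ℕ × ℕ) => Nat.pair (fstB r y.2)
      (Nat.pair y.1.unpair.1 (sndB r (Nat.pair y.1.unpair.1 y.2)))) h2 ?_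
    exact CRel.natPair (CRel.comp (f := fun r n => fstB r n) CFun.fstB CRel.snd)
      (CRel.natPair (h1.comp CRel.fst) (CRel.comp (f := fun r n => sndB r n) CFun.sndB
        (CRel.natPair (h1.comp CRel.fst) CRel.snd)))
  obtain ⟨S₁, hS₁, hSf₁⟩ := exists_closedRep hf₁
  obtain ⟨S₂, hS₂, hSf₂⟩ := exists_closedRep hf₂
  have hK : CFun fun z n =>
      Nat.pair (fstB (sndB z) 0) (sndB (sndB z) (Nat.pair (fstB (sndB z) 0) n)) := by
    have h3 : CRel fun z (n : ℕ) => fstB (sndB z) n := CFun.fstB.comp CFun.sndB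
    have h4 : CRel fun z (n : ℕ) => sndB (sndB z) n := CFun.sndB.comp CFun.sndB
    exact CRel.natPair (h3.comp (CRel.const 0))
      (h4.comp (CRel.natPair (h3.comp (CRel.const 0)) CRel.id))
  refine ⟨_, _, hK, hS₁.pairB hS₂, fun p A hA hne => ?_⟩
  have hAOK : ∀ i y, (i, y) ∈ A.1 ↔ ∀ n, OK p i y n := by
    intro i y
    have := (hit_closedRep hA (natCantorName_names i y)).symm.trans (htest _)
    rw [← not_iff_not, this, not_forall]
  obtain ⟨B₁, hB₁, hSB₁⟩ := hSf₁ ℕ natRep p {i | ∀ n, ∃ y, OK p i y n} fun q i hq => by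
    have hq : q 0 = i := hq
    simp only [f₁, fstB_pairB, sndB_pairB, hq, mem_ofPred_eq, not_forall, ← hgOK]
    exact exists_congr fun n => by omega
  obtain ⟨B₂, hB₂, hSB₂⟩ := hSf₂ (ℕ → Bool) cantorRep p
      {y | ∀ i n, (∃ y', OK p i y' n) → OK p i (fun k => y (Nat.pair i k)) n} fun q y hq => by
    have hq : ∀ k, q k = (y k).toNat := hq
    have h3 : ∀ i n, (List.range n).map (fun k => Nat.pair (p k) (Nat.pair i (q (Nat.pair i k)))) =
        word (pairB p (natCantorName i fun k => y (Nat.pair i k))) n := by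
      intro i n
      simp [word, pairB, natCantorName, hq]
    simp only [f₂, fstB_pairB, sndB_pairB, mem_ofPred_eq, not_forall, ← hgOK, h3, OK]
    constructor
    · rintro ⟨c, hc⟩
      exact ⟨c.unpair.1, c.unpair.2, by omega, by omega⟩
    · rintro ⟨i, n, h4, h5⟩
      refine ⟨Nat.pair i n, ?_⟩
      rw [Nat.unpair_pair]
      dsimp only
      omega
  refine ⟨(B₁, B₂), ⟨by rw [fstB_pairB]; exact hSB₁, by rw [sndB_pairB]; exact hSB₂⟩, ?_, ?_⟩
  · obtain ⟨⟨i, y⟩, hiy⟩ := hne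
    refine Nonempty.prod ⟨i, hB₁.ge fun n => ⟨y, (hAOK i y).1 hiy n⟩⟩ ?_
    choose b hb using fun i => exists_branch (hloc p i) (hanti p i) fun _ => ht0
    refine ⟨fun c => b c.unpair.1 c.unpair.2, hB₂.ge fun i n hn => ?_⟩
    simpa only [Nat.unpair_pair] using hb i n hn
  · rintro r ⟨i, y⟩ ⟨hi, hy⟩ ⟨hri, hry⟩
    have hri : fstB r 0 = i := hri
    have hry : ∀ k, sndB r k = (y k).toNat := hry
    -- `B₁` makes every level of tree `i` non-empty, which discharges the premise in `B₂`.
    refine ⟨(i, fun k => y (Nat.pair i k)), (hAOK _ _).2 fun n => hB₂.le hy i n (hB₁.le hi n), ?_⟩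
    convert natCantorName_names i (fun k => y (Nat.pair i k)) using 1
    funext n
    simp [sndB_pairB, natCantorName, pairB, hri, hry]

/-! ### Coding the points of `ℕ × {0,1}^ℕ` as real numbers -/

theorem dist_le_of_cauchyRep {X : Type*} [MetricSpace X] {α : ℕ → X} {hα : DenseRange α}
    {p : Baire} {x : X} (h : (cauchyRep α hα).names p x) (j : ℕ) :
    dist (α (p j)) x ≤ (1 / 2 : ℝ) ^ j := by
  refine le_of_tendsto (tendsto_const_nhds.dist h.2) ?_
  filter_upwards [eventually_gt_atTop j] with i hi
  rw [dist_comm]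
  exact (h.1 i j hi).le

theorem ratNum_cast (c : ℕ) : (ratNum c : ℝ) =
    ((c.unpair.1 : ℝ) - c.unpair.2.unpair.1) / ((c.unpair.2.unpair.2 : ℝ) + 1) := by
  simp [ratNum]

/-- The minuend in the numerator of `N * ratNum c + 1 / 8`. -/
def scaledNum (N c : ℕ) : ℕ := 8 * N * c.unpair.1 + (c.unpair.2.unpair.2 + 1)

/-- The subtrahend in the numerator of `N * ratNum c + 1 / 8`. -/
def scaledSub (N c : ℕ) : ℕ := 8 * N * c.unpair.2.unpair.1

/-- The denominator of `N * ratNum c + 1 / 8`. -/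
def scaledDen (c : ℕ) : ℕ := 8 * (c.unpair.2.unpair.2 + 1)

theorem scaled_eq (N c : ℕ) :
    (N : ℝ) * ratNum c + 1 / 8 = ((scaledNum N c : ℝ) - scaledSub N c) / scaledDen c := by
  rw [ratNum_cast, scaledNum, scaledSub, scaledDen]
  have : ((c.unpair.2.unpair.2 : ℝ) + 1) ≠ 0 := by positivity
  push_cast
  field_simp
  ring

theorem scaledDen_pos (c : ℕ) : (0 : ℝ) < scaledDen c := by
  rw [scaledDen]; positivity

/-- The truncated subtraction in `scaledFloor` is faithful only for non-negative numbers; this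
comparison decides that case. -/
theorem scaled_nonneg_iff (N c : ℕ) :
    0 ≤ (N : ℝ) * ratNum c + 1 / 8 ↔ scaledSub N c ≤ scaledNum N c := by
  rw [scaled_eq, le_div_iff₀ (scaledDen_pos c), zero_mul, sub_nonneg, Nat.cast_le]

/-- The integer part of `N * ratNum c + 1 / 8`, if that number is non-negative. -/
def scaledFloor (N c : ℕ) : ℕ := (scaledNum N c - scaledSub N c) / scaledDen c

theorem scaledFloor_eq {N c : ℕ} (h : 0 ≤ (N : ℝ) * ratNum c + 1 / 8) :
    scaledFloor N c = ⌊(N : ℝ) * ratNum c + 1 / 8⌋₊ := by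
  rw [scaledFloor, scaled_eq, ← Nat.cast_sub ((scaled_nonneg_iff N c).1 h), Nat.floor_div_natCast,
    Nat.floor_natCast]

/-- The integer with base-`4` digits given by `m` and, doubled, by the first `n` entries of `y`. -/
def quaternary (m : ℕ) (y : ℕ → Bool) : ℕ → ℕ
  | 0 => m
  | n + 1 => 4 * quaternary m y n + 2 * (y n).toNat

/-- `x` is the real number `m + ∑ 2 yᵢ 4^{-i-1}`. -/
def IsQuaternary (x : ℝ) (z : ℕ × (ℕ → Bool)) : Prop :=
  ∀ n, (quaternary z.1 z.2 n : ℝ) / 4 ^ n ≤ x ∧ x ≤ ((quaternary z.1 z.2 n : ℝ) + 2 / 3) / 4 ^ n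

/-- The intervals are nested: `2 / 3` is the largest possible tail `∑ 2 · 4^{-i-1}`, and `4 * (2 /
3) = 2 + 2 / 3`. -/
theorem exists_isQuaternary (z : ℕ × (ℕ → Bool)) : ∃ x, IsQuaternary x z := by
  have hf : Monotone fun n => (quaternary z.1 z.2 n : ℝ) / 4 ^ n := by
    refine monotone_nat_of_le_succ fun n => ?_
    rw [div_le_div_iff₀ (by positivity) (by positivity), quaternary, pow_succ]
    push_cast
    have : (0 : ℝ) ≤ 2 * ((z.2 n).toNat : ℝ) * 4 ^ n := by positivity
    nlinarith
  have hg : Antitone fun n => ((quaternary z.1 z.2 n : ℝ) + 2 / 3) / 4 ^ n := by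
    refine antitone_nat_of_succ_le fun n => ?_
    rw [div_le_div_iff₀ (by positivity) (by positivity), quaternary, pow_succ]
    push_cast
    have h1 : ((z.2 n).toNat : ℝ) ≤ 1 := by exact_mod_cast Bool.toNat_le _
    have : (0 : ℝ) ≤ (1 - ((z.2 n).toNat : ℝ)) * 4 ^ n :=
      mul_nonneg (sub_nonneg.2 h1) (by positivity)
    nlinarith
  have hfg : ∀ n, (quaternary z.1 z.2 n : ℝ) / 4 ^ n ≤
      ((quaternary z.1 z.2 n : ℝ) + 2 / 3) / 4 ^ n := fun n => by gcongr; linarith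
  have h := hf.ciSup_mem_iInter_Icc_of_antitone hg hfg
  exact ⟨_, fun n => mem_iInter.1 h n⟩

/-- The approximation to the `n`-th quaternary integer of a real number with name `q`. -/
def quatApprox (q : Baire) (n : ℕ) : ℕ := scaledFloor (4 ^ n) (q (2 * n + 3))

/-- The `n`-th digit read off from a name of a real number. -/
def quatDigit (q : Baire) (n : ℕ) : ℕ :=
  if quatApprox q (n + 1) = 4 * quatApprox q n + 2 then 1 else 0

/-- Rejects the names of the real numbers that code no point of `ℕ × {0,1}^ℕ`. -/
def quatTest (q : Baire) : Baire := fun n =>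
  if scaledSub (4 ^ n) (q (2 * n + 3)) ≤ scaledNum (4 ^ n) (q (2 * n + 3)) ∧
    quatApprox q (n + 1) = 4 * quatApprox q n + 2 * quatDigit q n then 1 else 0

/-! ### Computability of the quaternary decoding -/

section

open CRel

theorem crel_scaled : (CRel fun q (n : ℕ) => scaledNum (4 ^ n) (q (2 * n + 3))) ∧
    (CRel fun q (n : ℕ) => scaledSub (4 ^ n) (q (2 * n + 3))) ∧
    CRel fun q (n : ℕ) => scaledDen (q (2 * n + 3)) := by
  have hc : CRel fun q (n : ℕ) => q (2 * n + 3) := get (((const 2).mul id).add (const 3))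
  have hN : CRel fun _ (n : ℕ) => 8 * 4 ^ n := (const 8).mul ((const 4).pow id)
  have hd := (unpair_snd (unpair_snd hc)).add (const 1)
  exact ⟨(hN.mul (unpair_fst hc)).add hd, hN.mul (unpair_fst (unpair_snd hc)), (const 8).mul hd⟩

theorem crel_quatApprox : CRel quatApprox :=
  (crel_scaled.1.sub crel_scaled.2.1).div crel_scaled.2.2

theorem crel_quatDigit : CRel quatDigit :=
  ite ((crel_quatApprox.comp (id.add (const 1))).decide_eq
    (((const 4).mul crel_quatApprox).add (const 2))) (const 1) (const 0)

theorem cfun_quatTest : CFun quatTest :=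
  ite ((crel_scaled.2.1.decide_le crel_scaled.1).decide_and
    ((crel_quatApprox.comp (id.add (const 1))).decide_eq
    (((const 4).mul crel_quatApprox).add ((const 2).mul crel_quatDigit)))) (const 1) (const 0)

end

theorem abs_ratNum_sub_le {q : Baire} {x : ℝ} (hq : realRep.names q x) (n : ℕ) :
    |(4 : ℝ) ^ n * ratNum (q (2 * n + 3)) - 4 ^ n * x| ≤ 1 / 8 := by
  have h := dist_le_of_cauchyRep hq (2 * n + 3)
  rw [Real.dist_eq, pow_add, pow_mul] at h
  rw [← mul_sub, abs_mul, abs_of_pos (by positivity)]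
  calc (4 : ℝ) ^ n * |(ratNum (q (2 * n + 3)) : ℝ) - x|
      ≤ 4 ^ n * (((1 / 2) ^ 2) ^ n * (1 / 2) ^ 3) := by gcongr
    _ = (4 * (1 / 2) ^ 2) ^ n * (1 / 2) ^ 3 := by rw [mul_pow]; ring
    _ = 1 / 8 := by norm_num

/-- The digits `0` and `2` leave gaps: `4 ^ n * x` lies within `2 / 3` above the quaternary integer.
Entry `2 * n + 3` of the name has scaled error at most `1 / 8`, so after adding `1 / 8` the excess
is between `0` and `11 / 12`, and the floor is exact. -/
theorem quatApprox_eq {q : Baire} {x : ℝ} (hq : realRep.names q x) {z : ℕ × (ℕ → Bool)}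
    (hx : IsQuaternary x z) (n : ℕ) :
    scaledSub (4 ^ n) (q (2 * n + 3)) ≤ scaledNum (4 ^ n) (q (2 * n + 3)) ∧
      quatApprox q n = quaternary z.1 z.2 n := by
  have h := abs_le.1 (abs_ratNum_sub_le hq n)
  obtain ⟨h1, h2⟩ := hx n
  rw [div_le_iff₀' (by positivity)] at h1
  rw [le_div_iff₀' (by positivity)] at h2
  have h3 : (0 : ℝ) ≤ quaternary z.1 z.2 n := Nat.cast_nonneg _
  have h4 : (0 : ℝ) ≤ ((4 ^ n : ℕ) : ℝ) * ratNum (q (2 * n + 3)) + 1 / 8 := by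
    push_cast; linarith
  refine ⟨(scaled_nonneg_iff _ _).1 h4, ?_⟩
  rw [quatApprox, scaledFloor_eq h4, Nat.floor_eq_iff h4]
  push_cast
  constructor <;> linarith

theorem quatDigit_eq {q : Baire} {x : ℝ} (hq : realRep.names q x) {z : ℕ × (ℕ → Bool)}
    (hx : IsQuaternary x z) (n : ℕ) : quatDigit q n = (z.2 n).toNat := by
  rw [quatDigit, (quatApprox_eq hq hx _).2, (quatApprox_eq hq hx _).2, quaternary]
  cases z.2 n <;> simp

theorem quatTest_iff {q : Baire} {x : ℝ} (hq : realRep.names q x) :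
    (∃ n, quatTest q n = 0) ↔ ¬ ∃ z, IsQuaternary x z := by
  rw [← not_iff_not, not_not, not_exists]
  simp only [quatTest, ite_eq_right_iff, one_ne_zero, imp_false, not_not]
  constructor
  · intro h
    let z : ℕ × (ℕ → Bool) := (quatApprox q 0, fun n => decide (quatDigit q n = 1))
    have hz : ∀ n, quaternary z.1 z.2 n = quatApprox q n := by
      intro n
      induction n with
      | zero => rfl
      | succ n ih =>
        rw [quaternary, ih, (h n).2]
        have : (z.2 n).toNat = quatDigit q n := by
          simp only [z, quatDigit]
          split_ifs <;> simp
        rw [this]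
    obtain ⟨x', hx'⟩ := exists_isQuaternary z
    refine ⟨z, ?_⟩
    suffices x = x' by rwa [this]
    -- Both `4 ^ n * x` and `4 ^ n * x'` are near the integer `quatApprox q n`; the factor `2` is a
    -- crude bound that suffices to force `x = x'`.
    have hle : ∀ n : ℕ, |x - x'| ≤ 2 * (1 / 4 : ℝ) ^ n := by
      intro n
      have h1 := abs_le.1 (abs_ratNum_sub_le hq n)
      have h4 := (scaled_nonneg_iff _ _).2 (h n).1
      have h5 := (Nat.floor_eq_iff h4).1 (scaledFloor_eq h4).symm
      change (quatApprox q n : ℝ) ≤ _ ∧ _ < (quatApprox q n : ℝ) + 1 at h5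
      push_cast at h5
      obtain ⟨h2, h3⟩ := hx' n
      rw [hz, div_le_iff₀' (by positivity)] at h2
      rw [hz, le_div_iff₀' (by positivity)] at h3
      have h6 : |(4 : ℝ) ^ n * (x - x')| ≤ 2 := by
        rw [abs_le, mul_sub]
        constructor <;> linarith
      rw [abs_mul, abs_of_pos (by positivity), ← le_div_iff₀' (by positivity)] at h6
      rwa [one_div, inv_pow, ← div_eq_mul_inv]
    have hlim : Tendsto (fun n : ℕ => 2 * (1 / 4 : ℝ) ^ n) atTop (𝓝 (2 * 0)) :=
      (tendsto_pow_atTop_nhds_zero_of_lt_one (by norm_num) (by norm_num)).const_mul 2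
    rw [mul_zero] at hlim
    exact sub_eq_zero.1 (abs_nonpos_iff.1 (ge_of_tendsto' hlim hle))
  · rintro ⟨z, hz⟩ n
    refine ⟨(quatApprox_eq hq hz n).1, ?_⟩
    rw [(quatApprox_eq hq hz _).2, (quatApprox_eq hq hz _).2, quatDigit_eq hq hz, quaternary]

/-- The codes form a closed set of reals, on which the digits can be read off without ambiguity. -/
theorem closedChoice_natCantor_reduction_real :
    TotalReduction (closedChoice (prodRep natRep cantorRep)) (closedChoice realRep) := by
  classical
  let E : Baire → Baire := fun q n => Nat.pair (quatApprox q 0) (quatDigit q n)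
  have hE : CFun E :=
    CRel.natPair (crel_quatApprox.comp (CRel.const 0)) crel_quatDigit
  have hEz : ∀ q x z, realRep.names q x → IsQuaternary x z →
      (prodRep natRep cantorRep).names (E q) z := by
    intro q x z hq hx
    constructor
    · change (Nat.unpair (Nat.pair _ _)).1 = z.1
      rw [Nat.unpair_pair]
      exact (quatApprox_eq hq hx 0).2
    · intro n
      change (Nat.unpair (Nat.pair _ _)).2 = _
      rw [Nat.unpair_pair]
      exact quatDigit_eq hq hx n
  let e : ℝ → ℕ × (ℕ → Bool) := fun x =>
    if h : ∃ z, IsQuaternary x z then h.choose else (0, fun _ => false)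
  have he : ∀ x z, IsQuaternary x z → IsQuaternary x (e x) := by
    intro x z hz
    have h : ∃ z, IsQuaternary x z := ⟨z, hz⟩
    simp only [e, dif_pos h]
    exact h.choose_spec
  refine closedChoice_reduction (D := {x | ∃ z, IsQuaternary x z}) (e := e) hE cfun_quatTest
    (fun q x hq => quatTest_iff hq) (fun q x ⟨z, hz⟩ hq => hEz q x _ hq (he x z hz)) fun z => ?_
  obtain ⟨x, hx⟩ := exists_isQuaternary z
  obtain ⟨q, hq⟩ := realRep.surj x
  -- `e x` was chosen arbitrarily among the points coded by `x`, but `E q` names both it and `z`, so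
  -- they agree.
  exact ⟨x, ⟨z, hx⟩, (prodRep natRep cantorRep).unique _ _ _
    (hEz q x _ hq (he x z hx)) (hEz q x z hq hx)⟩

/-! ### Euclidean spaces as images of `ℕ × {0,1}^ℕ` -/

theorem cauchyRep_names_of_dist_lt {X : Type*} [MetricSpace X] {α : ℕ → X} {hα : DenseRange α}
    {p : Baire} {x : X} (h : ∀ n, dist (α (p n)) x < (1 / 2 : ℝ) ^ (n + 1)) :
    (cauchyRep α hα).names p x := by
  refine ⟨fun i j hij => ?_, ?_⟩
  · have h1 := dist_triangle_right (α (p i)) (α (p j)) x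
    have h2 : (1 / 2 : ℝ) ^ (i + 1) ≤ (1 / 2 : ℝ) ^ (j + 1) :=
      pow_le_pow_of_le_one (by norm_num) (by norm_num) (by omega)
    have h3 : (1 / 2 : ℝ) ^ (j + 1) = (1 / 2 : ℝ) ^ j / 2 := by rw [pow_succ]; ring
    linarith [h i, h j]
  · rw [tendsto_iff_dist_tendsto_zero]
    have h0 : Tendsto (fun n : ℕ => (1 / 2 : ℝ) ^ (n + 1)) atTop (𝓝 0) :=
      (tendsto_pow_atTop_nhds_zero_of_lt_one (by norm_num) (by norm_num)).comp
        (tendsto_add_atTop_nat 1)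
    exact squeeze_zero (fun _ => dist_nonneg) (fun n => (h n).le) h0

theorem computable_entry : Computable₂ entry := by
  have h : CRel fun _ (x : ℕ × ℕ) => entry x.1 x.2 := by
    have h1 : CRel fun _ (u : (ℕ × ℕ) × ℕ × ℕ) => (Nat.unpair u.2.2).2 :=
      CRel.unpair_snd (CRel.snd.comp CRel.snd)
    refine (CRel.unpair_fst (CRel.nat_rec CRel.snd CRel.fst h1)).of_eq fun _ x => ?_
    rw [entry]
    congr 2
    induction x.2 with
    | zero => rfl
    | succ k ih => rw [Function.iterate_succ_apply', ← ih]
  exact h.computable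

/-- A code of the sequence `f 0, …, f (k - 1)`. -/
def vecCode : ℕ → (ℕ → ℕ) → ℕ
  | 0, _ => 0
  | k + 1, f => Nat.pair (f 0) (vecCode k fun i => f (i + 1))

theorem entry_vecCode {k : ℕ} (f : ℕ → ℕ) {i : ℕ} (hi : i < k) : entry (vecCode k f) i = f i := by
  induction k generalizing f i with
  | zero => omega
  | succ k ih =>
    cases i with
    | zero => simp [entry, vecCode]
    | succ i =>
      have := ih (fun i => f (i + 1)) (i := i) (by omega)
      simpa [entry, vecCode, Function.iterate_succ_apply] using this

theorem CRel.vecCode {α : Type*} [Primcodable α] {f : Baire → α × ℕ → ℕ} (hf : CRel f) (k : ℕ) :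
    CRel fun p a => vecCode k fun i => f p (a, i) := by
  induction k generalizing f with
  | zero => exact CRel.const 0
  | succ k ih =>
    exact CRel.natPair (hf.comp (CRel.id.pair (CRel.const 0)))
      (ih (hf.comp (CRel.fst.pair (CRel.snd.add (CRel.const 1)))))

/-- The index of `ratNum c + s / 2 ^ N`. -/
def addDyadic (c s N : ℕ) : ℕ :=
  Nat.pair (c.unpair.1 * 2 ^ N + s * (c.unpair.2.unpair.2 + 1))
    -- The `- 1` compensates for the `+ 1` that `ratNum` adds to the denominator.
    (Nat.pair (c.unpair.2.unpair.1 * 2 ^ N) ((c.unpair.2.unpair.2 + 1) * 2 ^ N - 1))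

theorem ratNum_addDyadic (c s N : ℕ) :
    (ratNum (addDyadic c s N) : ℝ) = ratNum c + (s : ℝ) / 2 ^ N := by
  have h : 1 ≤ (c.unpair.2.unpair.2 + 1) * 2 ^ N := Nat.one_le_iff_ne_zero.2 (by positivity)
  rw [ratNum_cast, ratNum_cast, addDyadic]
  simp only [Nat.unpair_pair]
  rw [Nat.cast_sub h]
  have : ((c.unpair.2.unpair.2 : ℝ) + 1) ≠ 0 := by positivity
  push_cast
  field_simp
  ring

/-- The real number `∑ yₜ 2^{-t-1}`. -/
noncomputable def binary (y : ℕ → Bool) : ℝ :=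
  Real.ofDigits fun t => if y t then (1 : Fin 2) else 0

/-- The integer with the binary digits `y 0, …, y (N - 1)`. -/
def binaryPrefix (y : ℕ → ℕ) (N : ℕ) : ℕ := ∑ t ∈ Finset.range N, y t * 2 ^ (N - 1 - t)

/-- The omitted tail is `2 ^ (-N)` times a binary expansion, whose value lies in `[0, 1]`. -/
theorem abs_binaryPrefix_sub_le (y : ℕ → Bool) (N : ℕ) :
    |(binaryPrefix (fun t => (y t).toNat) N : ℝ) / 2 ^ N - binary y| ≤ (1 / 2 : ℝ) ^ N := by
  rw [binary, Real.ofDigits_eq_sum_add_ofDigits _ N, binaryPrefix]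
  have h : ((∑ t ∈ Finset.range N, (y t).toNat * 2 ^ (N - 1 - t) : ℕ) : ℝ) / 2 ^ N =
      ∑ t ∈ Finset.range N, Real.ofDigitsTerm (fun t => if y t then (1 : Fin 2) else 0) t := by
    push_cast
    rw [Finset.sum_div]
    refine Finset.sum_congr rfl fun t ht => ?_
    obtain ⟨d, rfl⟩ := Nat.exists_eq_add_of_lt (Finset.mem_range.1 ht)
    rw [show t + d + 1 - 1 - t = d by omega, Real.ofDigitsTerm]
    cases y t
    · simp
    · simp
      field_simp
      ring
  rw [h, sub_add_cancel_left, abs_neg, abs_mul, abs_of_nonneg (by positivity),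
    abs_of_nonneg (Real.ofDigits_nonneg _), one_div, inv_pow]
  exact mul_le_of_le_one_right (by positivity) (Real.ofDigits_le_one _)

theorem exists_binary_eq {x : ℝ} (hx : x ∈ Icc (0 : ℝ) 1) : ∃ y, binary y = x := by
  obtain ⟨d, -, hd⟩ := Real.ofDigits_SurjOn (b := 2) (by norm_num) hx
  refine ⟨fun t => decide (d t = 1), ?_⟩
  rw [← hd, binary]
  congr 1
  funext t
  generalize d t = c
  fin_cases c <;> simp

theorem dist_le_of_forall_coord {k : ℕ} {x y : EuclideanSpace ℝ (Fin k)} {B : ℝ} (hB : 0 ≤ B)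
    (h : ∀ i, |x i - y i| ≤ B) : dist x y ≤ k * B := by
  rw [EuclideanSpace.dist_eq]
  refine Real.sqrt_le_iff.2 ⟨by positivity, ?_⟩
  calc ∑ i, dist (x i) (y i) ^ 2 ≤ ∑ _i : Fin k, B ^ 2 := by
        gcongr with i
        exact h i
    _ = k * B ^ 2 := by simp
    _ ≤ (k : ℝ) ^ 2 * B ^ 2 := by
        gcongr
        exact_mod_cast Nat.le_self_pow two_ne_zero k
    _ = (k * B) ^ 2 := by ring

/-- The surjection `(m, y) ↦ ratVec k m + (∑ₜ y ⟨j, t⟩ 2^{-t-1})ⱼ`. -/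
noncomputable def euclideanOfCantor (k : ℕ) (z : ℕ × (ℕ → Bool)) : EuclideanSpace ℝ (Fin k) :=
  WithLp.toLp 2 fun j => (ratNum (entry z.1 j) : ℝ) + binary fun t => z.2 (Nat.pair j t)

/-- Each coordinate splits into its floor and its fractional part, the latter expanded in binary. -/
theorem euclideanOfCantor_surjective (k : ℕ) : Function.Surjective (euclideanOfCantor k) := by
  intro x
  have h1 : ∀ j : Fin k, ∃ c, (ratNum c : ℝ) = ⌊x j⌋ := fun j => by
    obtain ⟨c, hc⟩ := ratNum_surjective (⌊x j⌋ : ℚ)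
    exact ⟨c, by rw [hc]; push_cast; rfl⟩
  choose c hc using h1
  have h2 : ∀ j : Fin k, ∃ y, binary y = x j - ⌊x j⌋ := fun j =>
    exists_binary_eq ⟨Int.fract_nonneg (x j), (Int.fract_lt_one (x j)).le⟩
  choose b hb using h2
  obtain ⟨m, hm⟩ := exists_entry k fun i => if h : i < k then c ⟨i, h⟩ else 0
  refine ⟨(m, fun n => if h : n.unpair.1 < k then b ⟨_, h⟩ n.unpair.2 else false), ?_⟩
  ext j
  simp [euclideanOfCantor, hm j j.2, hc, hb]

theorem closedChoice_euclidean_reduction_natCantor (k : ℕ) :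
    TotalReduction (closedChoice (euclideanRep k))
      (closedChoice (prodRep natRep cantorRep)) := by
  -- Precision `n + k + 2` per coordinate absorbs the factor `k` of `dist_le_of_forall_coord`,
  -- because `k < 2 ^ k`.
  let C : Baire → ℕ × ℕ → ℕ := fun q u =>
    addDyadic (entry (fstB q 0) u.2)
      (binaryPrefix (fun t => sndB q (Nat.pair u.2 t)) (u.1 + k + 2)) (u.1 + k + 2)
  have hN : CRel fun (_ : Baire) (u : ℕ × ℕ) => u.1 + k + 2 :=
    (CRel.fst.add (CRel.const k)).add (CRel.const 2)
  have hc : CRel fun q (u : ℕ × ℕ) => entry (fstB q 0) u.2 :=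
    CRel.map₂ computable_entry
      (CRel.comp (f := fun q n => fstB q n) CFun.fstB (CRel.const 0)) CRel.snd
  have hs : CRel fun q (u : ℕ × ℕ) =>
      binaryPrefix (fun t => sndB q (Nat.pair u.2 t)) (u.1 + k + 2) := by
    refine CRel.sum (f := fun q (v : (ℕ × ℕ) × ℕ) =>
      sndB q (Nat.pair v.1.2 v.2) * 2 ^ (v.1.1 + k + 2 - 1 - v.2)) hN ?_
    exact (CRel.comp (f := fun q n => sndB q n) CFun.sndB
      ((CRel.snd.comp CRel.fst).natPair CRel.snd)).mul
      ((CRel.const 2).pow (((hN.comp CRel.fst).sub (CRel.const 1)).sub CRel.snd))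
  have hC : CRel C := by
    have hd := (CRel.unpair_snd (CRel.unpair_snd hc)).add (CRel.const 1)
    have hp := (CRel.const 2).pow hN
    exact (((CRel.unpair_fst hc).mul hp).add (hs.mul hd)).natPair
      (((CRel.unpair_fst (CRel.unpair_snd hc)).mul hp).natPair ((hd.mul hp).sub (CRel.const 1)))
  refine closedChoice_reduction_of_surjective (E := fun q n => vecCode k fun j => C q (n, j))
    (CRel.vecCode hC k) (fun q z hq => ?_) (euclideanOfCantor_surjective k)
  have h1 : fstB q 0 = z.1 := hq.1
  have h2 : ∀ t, sndB q t = (z.2 t).toNat := hq.2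
  refine cauchyRep_names_of_dist_lt fun n => ?_
  refine (dist_le_of_forall_coord (B := (1 / 2 : ℝ) ^ (n + k + 2)) (by positivity)
    fun j => ?_).trans_lt ?_
  · simp only [ratVec, euclideanOfCantor, entry_vecCode _ j.2, C, ratNum_addDyadic, h1, h2,
      add_sub_add_left_eq_sub]
    exact abs_binaryPrefix_sub_le _ _
  · have h3 : (k : ℝ) < 2 ^ k := by exact_mod_cast Nat.lt_two_pow_self
    calc (k : ℝ) * (1 / 2 : ℝ) ^ (n + k + 2) < 2 ^ k * (1 / 2 : ℝ) ^ (n + k + 2) := by gcongr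
      _ = (2 * (1 / 2)) ^ k * (1 / 2 : ℝ) ^ (n + 2) := by rw [mul_pow]; ring
      _ = (1 / 2 : ℝ) ^ (n + 2) := by norm_num
      _ < (1 / 2 : ℝ) ^ (n + 1) := pow_lt_pow_right_of_lt_one₀ (by norm_num) (by norm_num) (by omega)

/-- Projection to the first coordinate is non-expanding, so first entries of the indices in a Cauchy
name again form a Cauchy name. -/
theorem closedChoice_real_reduction_euclidean {k : ℕ} (hk : 1 ≤ k) :
    TotalReduction (closedChoice realRep) (closedChoice (euclideanRep k)) := by
  refine closedChoice_reduction_of_surjective (e := fun x => x ⟨0, hk⟩)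
    (E := fun q n => entry (q n) 0) (CRel.map₂ computable_entry CRel.oracle (CRel.const 0))
    (fun q x hq => ⟨fun i j hij => ?_, ?_⟩) fun x => ⟨WithLp.toLp 2 fun _ => x, rfl⟩
  · refine lt_of_le_of_lt ?_ (hq.1 i j hij)
    rw [dist_eq_norm, dist_eq_norm]
    exact PiLp.norm_apply_le (ratVec k (q i) - ratVec k (q j)) ⟨0, hk⟩
  · exact ((PiLp.continuous_apply 2 (fun _ : Fin k => ℝ) ⟨0, hk⟩).tendsto x).comp hq.2

/-! ### `K_σ`-spaces as images of `ℕ × {0,1}^ℕ` -/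

theorem ratNum_le_iff (c n : ℕ) : (ratNum c : ℝ) ≤ (1 / 2 : ℝ) ^ n ↔
    2 ^ n * c.unpair.1 ≤ c.unpair.2.unpair.2 + 1 + 2 ^ n * c.unpair.2.unpair.1 := by
  rw [ratNum_cast, div_le_iff₀ (by positivity), one_div, inv_pow, inv_mul_eq_div,
    le_div_iff₀' (by positivity), mul_sub, sub_le_iff_le_add]
  exact_mod_cast Iff.rfl

/-- Decides whether the rational number with index `c` is at most `2 ^ (-n)`. -/
def ratLe (c n : ℕ) : Bool :=
  decide (2 ^ n * c.unpair.1 ≤ c.unpair.2.unpair.2 + 1 + 2 ^ n * c.unpair.2.unpair.1)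

theorem ratLe_iff (c n : ℕ) : ratLe c n = true ↔ (ratNum c : ℝ) ≤ (1 / 2 : ℝ) ^ n := by
  rw [ratLe, decide_eq_true_iff, ratNum_le_iff]

theorem computable_ratLe : Computable₂ ratLe := by
  have h : CRel fun _ (x : ℕ × ℕ) => ratLe x.1 x.2 := by
    have hp := (CRel.const 2).pow (CRel.snd (α := ℕ) (β := ℕ))
    have h2 := CRel.unpair_snd (CRel.fst (α := ℕ) (β := ℕ))
    exact (hp.mul (CRel.unpair_fst CRel.fst)).decide_le
      (((CRel.unpair_snd h2).add (CRel.const 1)).add (hp.mul (CRel.unpair_fst h2)))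
  exact h.computable

/-- Decides whether all the balls of a list have radius at most `2 ^ (-n)`. -/
def radiiLe (l : List (ℕ × ℕ)) (n : ℕ) : Bool := decide
  (∑ k ∈ Finset.range l.length, (if ratLe (l.getD k (0, 0)).2 n then 0 else 1) = 0)

theorem radiiLe_iff (l : List (ℕ × ℕ)) (n : ℕ) :
    radiiLe l n = true ↔ ∀ b ∈ l, (ratNum b.2 : ℝ) ≤ (1 / 2 : ℝ) ^ n := by
  rw [radiiLe, decide_eq_true_iff, Finset.sum_eq_zero_iff]
  simp only [Finset.mem_range, ite_eq_left_iff, one_ne_zero, imp_false, not_not, ratLe_iff]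
  constructor
  · intro h b hb
    obtain ⟨k, hk, rfl⟩ := List.getElem_of_mem hb
    simpa [hk] using h k hk
  · intro h k hk
    exact h _ (by simp [hk])

theorem computable_radiiLe : Computable₂ radiiLe := by
  have h : CRel fun _ (x : List (ℕ × ℕ) × ℕ) => radiiLe x.1 x.2 := by
    refine CRel.decide_eq (CRel.sum (f := fun _ (y : (List (ℕ × ℕ) × ℕ) × ℕ) =>
      if ratLe (y.1.1.getD y.2 (0, 0)).2 y.1.2 then 0 else 1)
      (CRel.map Computable.list_length CRel.fst) ?_) (CRel.const 0)
    have h1 : CRel fun _ (y : (List (ℕ × ℕ) × ℕ) × ℕ) => (y.1.1.getD y.2 (0, 0)).2 :=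
      CRel.snd.comp (CRel.map₂ (g := fun (l : List (ℕ × ℕ)) k => l.getD k (0, 0))
        (Primrec.list_getD _).to_comp (CRel.fst.comp CRel.fst) CRel.snd)
    exact (CRel.cond (CRel.map₂ computable_ratLe h1 (CRel.snd.comp CRel.fst)) (CRel.const 0)
      (CRel.const 1)).of_eq fun _ y => by rw [cond_eq_ite]
  exact h.computable

/-- Guarantees that the search for a cover of prescribed fineness terminates. -/
theorem exists_small_coverCode {X : Type*} [MetricSpace X] {α : ℕ → X} (hα : DenseRange α)
    {K : Set X} (hK : IsCompact K) {ε : ℝ} (hε : 0 < ε) :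
    ∃ n, IsCoverCode α K n ∧
      ∀ b ∈ Denumerable.ofNat (List (ℕ × ℕ)) n, (ratNum b.2 : ℝ) ≤ ε := by
  have h : ∀ y, ∃ b : ℕ × ℕ, y ∈ ratBall α b ∧ (ratNum b.2 : ℝ) ≤ ε := by
    intro y
    obtain ⟨i, hi⟩ := hα.exists_dist_lt y hε
    obtain ⟨q, hq1, hq2⟩ := exists_rat_btwn hi
    obtain ⟨j, rfl⟩ := ratNum_surjective q
    exact ⟨(i, j), hq1, hq2.le⟩
  choose b hb using h
  obtain ⟨t, htK, ht⟩ := hK.elim_nhds_subcover (fun y => ratBall α (b y))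
    (fun y _ => Metric.isOpen_ball.mem_nhds (hb y).1)
  refine ⟨Encodable.encode (t.toList.map b), ⟨?_, ?_⟩, ?_⟩
  · rw [Denumerable.ofNat_encode]
    intro z hz
    obtain ⟨y, hy, hzy⟩ := mem_iUnion₂.1 (ht hz)
    exact mem_iUnion₂.2 ⟨b y, List.mem_map.2 ⟨y, by simpa using hy, rfl⟩, hzy⟩
  · rw [Denumerable.ofNat_encode]
    intro c hc
    obtain ⟨y, hy, rfl⟩ := List.mem_map.1 hc
    exact ⟨y, (hb y).1, htK y (by simpa using hy)⟩
  · rw [Denumerable.ofNat_encode]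
    intro c hc
    obtain ⟨y, hy, rfl⟩ := List.mem_map.1 hc
    exact (hb y).2

/-- A computable sequence of compact sets has uniformly computable covers by small balls. -/
theorem exists_computable_covers {X : Type*} [MetricSpace X] {α : ℕ → X} (hα : DenseRange α)
    {K : ℕ → TopologicalSpace.Compacts X} (hK : ComputableMap natRep (compactRep α hα) K) :
    ∃ L : ℕ → ℕ → List (ℕ × ℕ), Computable₂ L ∧ ∀ i n,
      ((K i : Set X) ⊆ ⋃ b ∈ L i n, ratBall α b) ∧
      (∀ b ∈ L i n, (ratBall α b ∩ K i).Nonempty) ∧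
      ∀ b ∈ L i n, (ratNum b.2 : ℝ) ≤ (1 / 2 : ℝ) ^ n := by
  obtain ⟨F, ⟨φ, hφ, hmono, hF⟩, hFK⟩ := hK
  let cst : ℕ → Baire := fun i _ => i
  -- `s` codes an input length and a position in the output word; the cover found there is kept only
  -- if all its radii are small.
  let S : ℕ × ℕ → ℕ → Option (List (ℕ × ℕ)) := fun x s =>
    ((φ (word (cst x.1) s.unpair.1))[s.unpair.2]?).bind fun v =>
      bif radiiLe (Denumerable.ofNat (List (ℕ × ℕ)) v) x.2 then
        some (Denumerable.ofNat (List (ℕ × ℕ)) v) else none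
  have hS : Computable₂ S := by
    have hw : Computable fun y : (ℕ × ℕ) × ℕ => word (cst y.1.1) y.2.unpair.1 := by
      have h : CRel fun _ (y : (ℕ × ℕ) × ℕ) =>
          (List.range y.2.unpair.1).map fun _ => y.1.1 :=
        CRel.tabulate (f := fun _ (w : ((ℕ × ℕ) × ℕ) × ℕ) => w.1.1.1)
          (CRel.unpair_fst CRel.snd) (CRel.fst.comp (CRel.fst.comp CRel.fst))
      exact h.computable
    refine Computable.option_bind (Computable.list_getElem?.comp (hφ.comp hw)
      (Computable.snd.comp (Computable.unpair.comp Computable.snd))) (Computable₂.mk ?_)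
    have hl : Computable fun y : ((ℕ × ℕ) × ℕ) × ℕ => Denumerable.ofNat (List (ℕ × ℕ)) y.2 :=
      (Computable.ofNat _).comp Computable.snd
    exact Computable.cond (computable_radiiLe.comp hl
      (Computable.snd.comp (Computable.fst.comp Computable.fst)))
      (Computable.option_some.comp hl) (Computable.const none)
  have hspec : ∀ i n s l, S (i, n) s = some l →
      ((K i : Set X) ⊆ ⋃ b ∈ l, ratBall α b) ∧ (∀ b ∈ l, (ratBall α b ∩ K i).Nonempty) ∧
      ∀ b ∈ l, (ratNum b.2 : ℝ) ≤ (1 / 2 : ℝ) ^ n := by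
    intro i n s l hl
    obtain ⟨v, hv, hl⟩ := Option.bind_eq_some_iff.1 hl
    rw [cond_eq_ite] at hl
    split_ifs at hl with hr
    obtain rfl := Option.some.inj hl
    obtain ⟨q, hq, _, rfl, hqK⟩ := hFK (cst i) i rfl ⟨_, rfl⟩
    -- Both the word inspected and a long prefix of `q` are prefixes of one output word, so they
    -- agree where both are defined.
    have hqv : q s.unpair.2 = v := by
      obtain ⟨m, hm⟩ := (hF _ _).1 hq (s.unpair.2 + 1)
      have h1 := hm.trans (hmono _ _ (word_prefix (cst i) (le_max_left m s.unpair.1)))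
      have h2 := hmono _ _ (word_prefix (cst i) (le_max_right m s.unpair.1))
      have h3 := List.prefix_iff_getElem?.1 h1 s.unpair.2 (by simp [length_word])
      obtain ⟨hlt, h5⟩ := List.getElem?_eq_some_iff.1 hv
      have h4 := List.prefix_iff_getElem?.1 h2 s.unpair.2 hlt
      rw [h3] at h4
      have h6 := (Option.some.inj h4).trans h5
      simpa [word] using h6
    have hcov : IsCoverCode α (K i : Set X) v := by
      have : v ∈ Set.range q := ⟨_, hqv⟩
      rwa [show Set.range q = _ from hqK] at this
    exact ⟨hcov.1, hcov.2, (radiiLe_iff _ _).1 hr⟩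
  have hex : ∀ i n, ∃ s l, l ∈ S (i, n) s := by
    intro i n
    obtain ⟨v, hv, hr⟩ := exists_small_coverCode hα (K i).isCompact
      (show (0 : ℝ) < (1 / 2) ^ n by positivity)
    obtain ⟨q, hq, _, rfl, hqK⟩ := hFK (cst i) i rfl ⟨_, rfl⟩
    obtain ⟨j, rfl⟩ : v ∈ Set.range q := by
      rw [show Set.range q = _ from hqK]
      exact hv
    obtain ⟨m, hm⟩ := (hF _ _).1 hq (j + 1)
    have h3 := List.prefix_iff_getElem?.1 hm j (by simp [length_word])
    refine ⟨Nat.pair m j, Denumerable.ofNat (List (ℕ × ℕ)) (q j),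
      Option.bind_eq_some_iff.2 ⟨q j, ?_, ?_⟩⟩
    · simpa [word] using h3
    · rw [(radiiLe_iff _ _).2 hr]
      rfl
  have hdom : ∀ x : ℕ × ℕ, (Nat.rfindOpt (S x)).Dom := fun x => Nat.rfindOpt_dom.2 (hex x.1 x.2)
  refine ⟨fun i n => (Nat.rfindOpt (S (i, n))).get (hdom (i, n)),
    (Partrec.rfindOpt hS).of_eq_tot fun x => Part.get_mem (hdom x), fun i n => ?_⟩
  obtain ⟨s, hs⟩ := Nat.rfindOpt_spec (Part.get_mem (hdom (i, n)))
  exact hspec i n s _ hs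

/-- Follow the sequence `b` of indices, omitting all entries that are not close to the last one
taken, with `a` approximating the distances. -/
def walk (a : ℕ × ℕ × ℕ → ℕ) (b : ℕ → ℕ) : ℕ → ℕ
  | 0 => b 0
  -- Threshold `2 ^ (-(n + 2))` plus approximation error `2 ^ (-(n + 3))` bounds an accepted step by
  -- `3 / 8 * 2 ^ (-n)`.
  | n + 1 => bif ratLe (a (walk a b n, b (n + 1), n + 3)) (n + 2) then b (n + 1) else walk a b n

/-! ### Cauchy names from arbitrary sequences of indices -/

section Walk

variable {X : Type*} [MetricSpace X] {α : ℕ → X} {a : ℕ × ℕ × ℕ → ℕ}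

theorem dist_walk_succ_le
    (ha : ∀ i j m, |(ratNum (a (i, j, m)) : ℝ) - dist (α i) (α j)| ≤ (1 / 2 : ℝ) ^ m) (b : ℕ → ℕ)
    (n : ℕ) :
    dist (α (walk a b n)) (α (walk a b (n + 1))) ≤ 3 / 8 * (1 / 2 : ℝ) ^ n := by
  rw [walk]
  cases h : ratLe (a (walk a b n, b (n + 1), n + 3)) (n + 2) with
  | false => simp
  | true =>
    have h1 := (ratLe_iff _ _).1 h
    have h2 := abs_le.1 (ha (walk a b n) (b (n + 1)) (n + 3))
    rw [pow_add] at h1 h2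
    simp only [cond_true]
    linarith

theorem dist_walk_lt
    (ha : ∀ i j m, |(ratNum (a (i, j, m)) : ℝ) - dist (α i) (α j)| ≤ (1 / 2 : ℝ) ^ m) (b : ℕ → ℕ)
    {i j : ℕ} (hij : j < i) :
    dist (α (walk a b i)) (α (walk a b j)) < (1 / 2 : ℝ) ^ j := by
  -- The partial geometric sum of the step bounds; its limit `3 / 4 * 2 ^ (-j)` stays below the
  -- required `2 ^ (-j)`.
  have key : ∀ d, dist (α (walk a b j)) (α (walk a b (j + d))) ≤
      3 / 4 * (1 / 2 : ℝ) ^ j * (1 - (1 / 2) ^ d) := by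
    intro d
    induction d with
    | zero => simp
    | succ d ih =>
      have h1 := dist_walk_succ_le ha b (j + d)
      have h2 := dist_triangle (α (walk a b j)) (α (walk a b (j + d))) (α (walk a b (j + d + 1)))
      rw [pow_add] at h1
      rw [pow_succ, ← add_assoc]
      linarith
  obtain ⟨d, rfl⟩ := Nat.exists_eq_add_of_lt hij
  have h1 := key (d + 1)
  have h2 : 3 / 4 * (1 / 2 : ℝ) ^ j * (1 - (1 / 2) ^ (d + 1)) ≤ 3 / 4 * (1 / 2 : ℝ) ^ j * 1 := by
    gcongr
    have : (0 : ℝ) < (1 / 2) ^ (d + 1) := by positivity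
    linarith
  have h3 : (0 : ℝ) < (1 / 2) ^ j := by positivity
  rw [dist_comm, add_assoc]
  linarith

/-- Either `walk` meets `b` infinitely often, so that a subsequence stays close to `K` and
compactness gives a limit, or it is eventually constant. Completeness of `X` is not needed. -/
theorem exists_tendsto_walk
    (ha : ∀ i j m, |(ratNum (a (i, j, m)) : ℝ) - dist (α i) (α j)| ≤ (1 / 2 : ℝ) ^ m) (b : ℕ → ℕ)
    {K : Set X} (hK : IsCompact K)
    (hb : ∀ n, ∃ z ∈ K, dist (α (b n)) z ≤ (1 / 2 : ℝ) ^ n) :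
    ∃ x, Tendsto (fun n => α (walk a b n)) atTop (𝓝 x) := by
  have hlim : Tendsto (fun n : ℕ => (1 / 2 : ℝ) ^ n) atTop (𝓝 0) :=
    tendsto_pow_atTop_nhds_zero_of_lt_one (by norm_num) (by norm_num)
  have hcau : CauchySeq fun n => α (walk a b n) := by
    refine cauchySeq_of_le_geometric (1 / 2) (3 / 8) (by norm_num) (dist_walk_succ_le ha b)
  by_cases h : ∃ᶠ n in atTop, walk a b n = b n
  · obtain ⟨φ, hφ, hφb⟩ := extraction_of_frequently_atTop h
    choose z hzK hz using hb
    obtain ⟨x, -, ψ, hψ, hx⟩ := hK.tendsto_subseq fun n => hzK (φ n)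
    have hφψ : Tendsto (fun n => φ (ψ n)) atTop atTop := hφ.tendsto_atTop.comp hψ.tendsto_atTop
    refine ⟨x, tendsto_nhds_of_cauchySeq_of_subseq hcau hφψ ?_⟩
    refine (tendsto_iff_of_dist ?_).2 hx
    refine squeeze_zero (fun _ => dist_nonneg) (fun n => ?_) (hlim.comp hφψ)
    simp only [Function.comp, hφb]
    exact hz _
  · rw [not_frequently] at h
    obtain ⟨N, hN⟩ := eventually_atTop.1 h
    refine ⟨α (walk a b N), tendsto_atTop_of_eventually_const (i₀ := N) fun n hn => ?_⟩
    induction n, hn using Nat.le_induction with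
    | base => rfl
    | succ n hn ih =>
      have h1 := hN (n + 1) (by omega)
      rw [walk] at h1 ⊢
      cases h2 : ratLe (a (walk a b n, b (n + 1), n + 3)) (n + 2) with
      | false => exact ih
      | true => simp [h2] at h1

/-- Nothing is skipped on a coherent sequence: distances `(1 / 16 + 1 / 32) * 2 ^ (-n)` plus error
`1 / 8 * 2 ^ (-n)` stay below the threshold `1 / 4 * 2 ^ (-n)`. -/
theorem walk_eq
    (ha : ∀ i j m, |(ratNum (a (i, j, m)) : ℝ) - dist (α i) (α j)| ≤ (1 / 2 : ℝ) ^ m) (b : ℕ → ℕ)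
    {x : X} (hx : ∀ n, dist x (α (b n)) ≤ (1 / 2 : ℝ) ^ (n + 4)) (n : ℕ) :
    walk a b n = b n := by
  induction n with
  | zero => rfl
  | succ n ih =>
    have h : ratLe (a (walk a b n, b (n + 1), n + 3)) (n + 2) = true := by
      rw [ratLe_iff, ih]
      have h1 := abs_le.1 (ha (b n) (b (n + 1)) (n + 3))
      have h2 := dist_triangle_left (α (b n)) (α (b (n + 1))) x
      have h3 := hx n
      have h4 := hx (n + 1)
      have h5 : (0 : ℝ) < (1 / 2) ^ n := by positivity
      simp only [pow_add] at h1 h3 h4 ⊢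
      linarith
    rw [walk, h, cond_true]

end Walk

/-- The centre of the ball of `l` selected by the digits of `y`. -/
def selectCentre (l : List (ℕ × ℕ)) (y : ℕ → ℕ) : ℕ :=
  (l.getD (∑ t ∈ Finset.range (l.length - 1), y t) (0, 0)).1

/-- Counting ones among `l.length - 1` digits always gives a valid index, so every Cantor point
makes a legal selection and the default is never used. -/
theorem selectCentre_mem {l : List (ℕ × ℕ)} (hl : l ≠ []) (y : ℕ → Bool) :
    ∃ b ∈ l, selectCentre l (fun t => (y t).toNat) = b.1 := by
  have h1 : ∑ t ∈ Finset.range (l.length - 1), (y t).toNat < l.length := by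
    have h2 : ∑ t ∈ Finset.range (l.length - 1), (y t).toNat ≤
        ∑ _t ∈ Finset.range (l.length - 1), 1 := Finset.sum_le_sum fun t _ => Bool.toNat_le _
    have h3 := List.length_pos_iff.2 hl
    rw [Finset.sum_const, Finset.card_range, smul_eq_mul, mul_one] at h2
    omega
  exact ⟨_, List.getElem_mem h1, by simp [selectCentre, h1]⟩

theorem exists_selectCentre_eq {l : List (ℕ × ℕ)} {b : ℕ × ℕ} (hb : b ∈ l) :
    ∃ y : ℕ → Bool, selectCentre l (fun t => (y t).toNat) = b.1 := by
  obtain ⟨k, hk, rfl⟩ := List.getElem_of_mem hb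
  refine ⟨fun t => decide (t < k), ?_⟩
  have : ∑ t ∈ Finset.range (l.length - 1), (decide (t < k)).toNat = k := by
    have h1 : ∀ t, (decide (t < k)).toNat = if t ∈ Finset.range k then 1 else 0 := by
      intro t
      by_cases h : t < k <;> simp [h]
    simp only [h1]
    rw [Finset.sum_ite_mem, Finset.inter_eq_right.2, Finset.sum_const, Finset.card_range,
      smul_eq_mul, mul_one]
    exact Finset.range_mono (by omega)
  simp [selectCentre, this, hk]

/-- The surjection sends `(i, y)` to the limit of the walk along the centres that `y` selects from
finer and finer covers of `K i`. -/
theorem closedChoice_kSigma_reduction_natCantor {X : Type*} [MetricSpace X]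
    (M : ComputableMetricSpace X) (hM : M.IsKSigma) :
    TotalReduction (closedChoice M.rep) (closedChoice (prodRep natRep cantorRep)) := by
  obtain ⟨K, hK, hne, hun⟩ := hM
  obtain ⟨L, hL, hLspec⟩ := exists_computable_covers M.dense hK
  obtain ⟨a, hacomp, ha⟩ := M.dist_computable
  let pick : Baire → ℕ → ℕ := fun q n =>
    selectCentre (L (fstB q 0) (n + 4)) fun t => sndB q (Nat.pair n t)
  have hpick : CRel pick := by
    have hl : CRel fun q (n : ℕ) => L (fstB q 0) (n + 4) :=
      CRel.map₂ hL (CRel.comp (f := fun q n => fstB q n) CFun.fstB (CRel.const 0))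
        (CRel.id.add (CRel.const 4))
    have hs : CRel fun q (n : ℕ) =>
        ∑ t ∈ Finset.range ((L (fstB q 0) (n + 4)).length - 1), sndB q (Nat.pair n t) :=
      CRel.sum (f := fun q (y : ℕ × ℕ) => sndB q (Nat.pair y.1 y.2))
        ((CRel.map Computable.list_length hl).sub (CRel.const 1))
        (CRel.comp (f := fun q n => sndB q n) CFun.sndB (CRel.fst.natPair CRel.snd))
    exact CRel.fst.comp (CRel.map₂ (g := fun (l : List (ℕ × ℕ)) k => l.getD k (0, 0))
      (Primrec.list_getD _).to_comp hl hs)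
  have hE : CFun fun q => walk a (pick q) := by
    have hb : CRel fun q (y : ℕ × ℕ × ℕ) => pick q (y.2.1 + 1) :=
      hpick.comp ((CRel.fst.comp CRel.snd).add (CRel.const 1))
    have hg : CRel fun q (y : ℕ × ℕ × ℕ) =>
        bif ratLe (a (y.2.2, pick q (y.2.1 + 1), y.2.1 + 3)) (y.2.1 + 2) then pick q (y.2.1 + 1)
          else y.2.2 :=
      CRel.cond (CRel.map₂ computable_ratLe
        (CRel.map hacomp ((CRel.snd.comp CRel.snd).pair (hb.pair
          ((CRel.fst.comp CRel.snd).add (CRel.const 3)))))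
        ((CRel.fst.comp CRel.snd).add (CRel.const 2))) hb (CRel.snd.comp CRel.snd)
    refine (CRel.nat_rec CRel.id (hpick.comp (CRel.const 0)) hg).of_eq fun q n => ?_
    induction n with
    | zero => rfl
    | succ n ih =>
      dsimp only at ih ⊢
      rw [walk, ← ih]
  -- `pick` reads only entry `0` of the first component, so the limit depends on the point `z` and
  -- not on its name.
  have hname : ∀ q z, (prodRep natRep cantorRep).names q z →
      pick q = pick (natCantorName z.1 z.2) := by
    intro q z hq
    have h1 : fstB q 0 = z.1 := hq.1
    have h2 : ∀ t, sndB q t = (z.2 t).toNat := hq.2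
    simp only [pick, natCantorName, fstB_pairB, sndB_pairB, h1, h2]
  have hne' : ∀ i n, L i n ≠ [] := by
    intro i n hnil
    obtain ⟨x, hx⟩ := hne i
    simpa [hnil] using (hLspec i n).1 hx
  have hball : ∀ {b : ℕ × ℕ} {x : X} {m : ℕ}, x ∈ ratBall M.α b →
      (ratNum b.2 : ℝ) ≤ (1 / 2 : ℝ) ^ m → dist x (M.α b.1) ≤ (1 / 2 : ℝ) ^ m := by
    intro b x m hx hr
    exact (show dist x (M.α b.1) < ratNum b.2 from hx).le.trans hr
  have hlim : ∀ z : ℕ × (ℕ → Bool), ∃ x,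
      Tendsto (fun n => M.α (walk a (pick (natCantorName z.1 z.2)) n)) atTop (𝓝 x) := by
    intro z
    refine exists_tendsto_walk ha _ (K z.1).isCompact fun n => ?_
    simp only [pick, natCantorName, fstB_pairB, sndB_pairB]
    obtain ⟨b, hb, hbeq⟩ :=
      selectCentre_mem (hne' z.1 (n + 4)) fun t => z.2 (Nat.pair n t)
    obtain ⟨x, hxb, hxK⟩ := (hLspec z.1 (n + 4)).2.1 b hb
    refine ⟨x, hxK, ?_⟩
    rw [hbeq, dist_comm]
    exact (hball hxb ((hLspec z.1 (n + 4)).2.2 b hb)).trans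
      (pow_le_pow_of_le_one (by norm_num) (by norm_num) (by omega))
  choose e he using hlim
  refine closedChoice_reduction_of_surjective (e := e) hE (fun q z hq => ?_) fun x => ?_
  · rw [hname q z hq]
    exact ⟨fun i j hij => dist_walk_lt ha _ hij, he z⟩
  -- For `x ∈ K i`, selecting at each precision a ball that contains `x` gives a coherent sequence,
  -- which the walk follows to `x`.
  · obtain ⟨i, hi⟩ := mem_iUnion.1 (hun.ge (mem_univ x))
    have h1 : ∀ n, ∃ y : ℕ → Bool,
        dist x (M.α (selectCentre (L i (n + 4)) fun t => (y t).toNat)) ≤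
          (1 / 2 : ℝ) ^ (n + 4) := by
      intro n
      obtain ⟨b, hb, hxb⟩ := mem_iUnion₂.1 ((hLspec i (n + 4)).1 hi)
      obtain ⟨y, hy⟩ := exists_selectCentre_eq hb
      exact ⟨y, by rw [hy]; exact hball hxb ((hLspec i (n + 4)).2.2 b hb)⟩
    choose y hy using h1
    refine ⟨(i, fun c => y c.unpair.1 c.unpair.2), ?_⟩
    have h2 : ∀ n, pick (natCantorName i fun c => y c.unpair.1 c.unpair.2) n =
        selectCentre (L i (n + 4)) fun t => (y n t).toNat := by
      intro n
      simp only [pick, natCantorName, fstB_pairB, sndB_pairB, Nat.unpair_pair]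
    have h3 := he (i, fun c => y c.unpair.1 c.unpair.2)
    simp only [walk_eq ha (pick (natCantorName i fun c => y c.unpair.1 c.unpair.2)) (x := x)
      (fun n => by rw [h2]; exact hy n), h2] at h3
    refine tendsto_nhds_unique h3 ?_
    rw [tendsto_iff_dist_tendsto_zero]
    have h0 : Tendsto (fun n : ℕ => (1 / 2 : ℝ) ^ (n + 4)) atTop (𝓝 0) :=
      (tendsto_pow_atTop_nhds_zero_of_lt_one (by norm_num) (by norm_num)).comp
        (tendsto_add_atTop_nat 4)
    exact squeeze_zero (fun _ => dist_nonneg) (fun n => by rw [dist_comm]; exact hy n) h0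

end TTE

theorem mainTheorem7 :
    (∀ (X : Type*) [MetricSpace X] (M : TTE.ComputableMetricSpace X), M.IsKSigma →
      TTE.WeihrauchLE (TTE.closedChoice M.rep)
        ((TTE.closedChoice TTE.natRep).prod (TTE.closedChoice TTE.cantorRep))) ∧
    ∀ k : ℕ, 1 ≤ k →
      TTE.WeihrauchEquiv (TTE.closedChoice (TTE.euclideanRep k)) (TTE.closedChoice TTE.realRep) ∧
      TTE.WeihrauchEquiv (TTE.closedChoice TTE.realRep)
        (TTE.closedChoice (TTE.prodRep TTE.natRep TTE.cantorRep)) ∧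
      TTE.WeihrauchEquiv (TTE.closedChoice (TTE.prodRep TTE.natRep TTE.cantorRep))
        ((TTE.closedChoice TTE.natRep).prod (TTE.closedChoice TTE.cantorRep)) := by
  refine ⟨fun X _ M hM => ((TTE.closedChoice_kSigma_reduction_natCantor M hM).trans
    TTE.closedChoice_natCantor_reduction).weihrauchLE, fun k hk => ?_⟩
  -- The cycle from `ℝ^k` to `ℕ × {0,1}^ℕ` to `ℝ` and back to `ℝ^k` gives the first two
  -- equivalences.
  have h1 := TTE.closedChoice_euclidean_reduction_natCantor k
  have h2 := TTE.closedChoice_natCantor_reduction_real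
  have h3 := TTE.closedChoice_real_reduction_euclidean hk
  exact ⟨⟨(h1.trans h2).weihrauchLE, h3.weihrauchLE⟩,
    ⟨(h3.trans h1).weihrauchLE, h2.weihrauchLE⟩,
    ⟨TTE.closedChoice_natCantor_reduction.weihrauchLE,
      (TTE.closedChoice_prod_reduction _ _).weihrauchLE⟩⟩
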